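/- **Quantum Gross–Tucker theorem.** *Conventions.* A quantum set $(B,\psi)$ is a finite-dimensional C*-algebra $B$ with a faithful positive functional $\psi: B\to\mathbb{C}$ such that $m m^*=\mathrm{Id}_B$, where $m: B\otimes B\to B$ is the multiplication and $m^*$ its adjoint for the inner products $\langle a,b\rangle_\psi=\psi(a^*b)$ on $B$ and $\langle\cdot,\cdot\rangle_{\psi\otimes\psi}$ on $B\otimes B$. A quantum graph (quantum adjacency matrix) on $(B,\psi)$ is a linear map $A:B\to B$ with $m(A\otimes A)m^*=A$ and $A(b^*)=A(b)^*$ for all $b\in B$. An isomorphism of quantum graphs from $A_1$ on $(B_1,\psi_1)$ to $A_2$ on $(B_2,\psi_2)$ is a $*$-isomorphism $\varphi:B_1\to B_2$ with $\psi_2\varphi=\psi_1$ and $\varphi A_1=A_2\varphi$; $\mathrm{Aut}(A)$ is the group of automorphisms of $A$, and $\mathrm{Aut}(B,\psi)$ is the group of $*$-automorphisms of $B$ preserving $\psi$. Let $G$ be a finite abelian group, $n=|G|$, and $\hat G=\mathrm{Hom}(G,\mathbb{T})$. Let $(\tilde B,\tilde\psi)$ be a quantum set and $\hat\alpha:\hat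 G\to\mathrm{Aut}(\tilde B,\tilde\psi)$ an action. The crossed product $\tilde B\rtimes_{\hat\alpha}\hat G$ consists of the formal sums $\sum_{\chi\in\hat G} b_\chi u_\chi$ with $b_\chi\in\tilde B$, with $(b u_\chi)(c u_\xi)=b\,\hat\alpha_\chi(c)u_{\chi\xi}$ and $(b u_\chi)^*=\hat\alpha_{\chi^{-1}}(b^*)u_{\chi^{-1}}$; it carries the functional $\psi_\rtimes(\sum_\chi b_\chi u_\chi)=n\tilde\psi(b_1)$ and the map $E_\rtimes(\sum_\chi b_\chi u_\chi)=n b_1$ to $\tilde B$. For a family $(u_\chi)_{\chi\in\hat G}$ in a finite-dimensional C*-algebra with a faithful positive functional $\psi$ put $$X_g(b)=\frac1n\sum_{\chi\in\hat G}\overline{\chi(g)}\,\psi(u_\chi^*b)\,u_\chi\qquad(g\in G).$$ A voltage quantum graph on $(\tilde B,\tilde\psi)$ with respect to $\hat\alpha$ is a family $\tilde A=(\tilde A_g)_{g\in G}$ of quantum adjacency matrices on $(\tilde B,\tilde\psi)$ with $\tilde A_g\hat\alpha_\chi=\hat\alpha_\chi\tilde A_g$ for all $g\in G$, $\chi\in\hat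 G$. Its derived quantum graph is the map $$\tilde A\rtimes_{\hat\alpha}\hat G=\sum_{g\in G}m(X_g\otimes E_\rtimes^*\tilde A_gE_\rtimes)m^*$$ on $(\tilde B\rtimes_{\hat\alpha}\hat G,\psi_\rtimes)$, where $m$, $X_g$ and the adjoints are those of the crossed product with $\psi_\rtimes$ (and $\tilde\psi$ on $\tilde B$). *Theorem.* Let $A:B\to B$ be a quantum graph on a quantum set $(B,\psi)$, and let $\alpha:G\to\mathrm{Aut}(A)$ be an action of a finite abelian group $G$ on $A$, that is, an action on the C*-algebra $B$ with $\psi\alpha_g=\psi$ and $\alpha_gA=A\alpha_g$ for all $g\in G$. Suppose that there is a unitary representation $(u_\chi)_{\chi\in\hat G}\subset B$ of $\hat G$ such that, for all $g\in G$ and $\chi\in\hat G$, $$\alpha_g(u_\chi)=\chi(g)u_\chi,\qquad \psi\,\mathrm{Ad}(u_\chi)=\psi,\qquad \mathrm{Ad}(u_\chi)A=A\,\mathrm{Ad}(u_\chi),$$ where $\mathrm{Ad}(u_\chi)(b)=u_\chi b u_\chi^*$. Let $B^\alpha$ be the fixed point algebra of $\alpha$, $\tilde\psi=\frac1n\psi|_{B^\alpha}$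 with $n=|G|$, and $\hat\alpha_\chi(b)=u_\chi b u_\chi^*$ for $b\in B^\alpha$. Then: 1. $(B^\alpha,\tilde\psi)$ is a quantum set, $\hat\alpha$ is an action of $\hat G$ on it, the maps $\tilde A_g=m(X_g\otimes A)m^*|_{B^\alpha}$ (with $m$, $m^*$ and $X_g$ formed in $B$ with respect to $\psi$ and $(u_\chi)_\chi$) map $B^\alpha$ into $B^\alpha$, and $\tilde A=(\tilde A_g)_{g\in G}$ is a voltage quantum graph on $(B^\alpha,\tilde\psi)$ with respect to $\hat\alpha$. 2. $\tilde A\rtimes_{\hat\alpha}\hat G$ is a quantum graph on $(B^\alpha\rtimes_{\hat\alpha}\hat G,\psi_\rtimes)$, and $A\cong\tilde A\rtimes_{\hat\alpha}\hat G$ as quantum graphs. -/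

import Mathlib

open scoped ComplexOrder TensorProduct

universe u v

noncomputable section

/-! ### Quantum sets -/

/-- A faithful positive linear functional on a (finite-dimensional) C*-algebra. -/
structure FaithfulFunctional (B : Type u) [CStarAlgebra B] where
  toLinearMap : B →ₗ[ℂ] ℂ
  nonneg : ∀ b : B, 0 ≤ toLinearMap (star b * b)
  faithful : ∀ b : B, toLinearMap (star b * b) = 0 → b = 0

namespace FaithfulFunctional

variable {B : Type u} [CStarAlgebra B] (ψ : FaithfulFunctional B)

instance : CoeFun (FaithfulFunctional B) (fun _ => B → ℂ) := ⟨fun ψ => ψ.toLinearMap⟩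

lemma map_star (b : B) : ψ (star b) = star (ψ b) := by
  have h0 := ψ.nonneg b
  have h1 := ψ.nonneg 1
  have h2 := ψ.nonneg (1 + b)
  have h3 := ψ.nonneg (1 + Complex.I • b)
  rw [Complex.le_def] at h0 h1 h2 h3
  simp only [star_add, star_one, star_smul, add_mul, mul_add, one_mul, mul_one, map_add,
    smul_mul_assoc, mul_smul_comm, map_smul, smul_eq_mul, Complex.add_im, Complex.mul_im,
    Complex.zero_im, Complex.star_def, Complex.conj_I, Complex.neg_re, Complex.neg_im,
    Complex.I_re, Complex.I_im, Complex.mul_re] at h0 h1 h2 h3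
  apply Complex.ext
  · simp only [Complex.star_def, Complex.conj_re]
    linarith [h0.2, h1.2, h2.2, h3.2]
  · simp only [Complex.star_def, Complex.conj_im]
    linarith [h0.2, h1.2, h2.2, h3.2]

/-- The inner product `⟨a, b⟩ = ψ (a* b)`, antilinear in the first variable. -/
@[reducible] def core : InnerProductSpace.Core ℂ B where
  inner a b := ψ (star a * b)
  conj_inner_symm a b := by
    have h := ψ.map_star (star b * a)
    rw [star_mul, star_star] at h
    exact h.symm
  re_inner_nonneg a := (Complex.le_def.1 (ψ.nonneg a)).1
  add_left a b c := by simp [add_mul]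
  smul_left a b r := by simp
  definite a h := ψ.faithful a h

/-- The GNS space `L²(B, ψ)`: the vector space `B` with the inner product `⟨a, b⟩ = ψ (a* b)`. -/
def L2 (_ψ : FaithfulFunctional B) : Type u := B

instance : NormedAddCommGroup ψ.L2 :=
  @InnerProductSpace.Core.toNormedAddCommGroup ℂ B _ _ _ ψ.core

instance : InnerProductSpace ℂ ψ.L2 :=
  @InnerProductSpace.ofCore ℂ B _ _ _ ψ.core.toCore

instance : Inner ℂ ψ.L2 := InnerProductSpace.toInner

instance : Inner ℂ (ψ.L2 ⊗[ℂ] ψ.L2) := InnerProductSpace.toInner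

/-- The identity map from `B` to `L²(B, ψ)`. -/
def toL2 : B ≃ₗ[ℂ] ψ.L2 := LinearEquiv.refl ℂ B

lemma inner_toL2 (a b : B) : inner ℂ (ψ.toL2 a) (ψ.toL2 b) = ψ (star a * b) := rfl

instance [FiniteDimensional ℂ B] : FiniteDimensional ℂ ψ.L2 :=
  ψ.toL2.finiteDimensional

variable [FiniteDimensional ℂ B]

/-- The adjoint `T* : C → B` of a linear map `T : B → C` with respect to the inner products
induced by `ψ` on `B` and `φ` on `C`. -/
def adjoint {C : Type v} [CStarAlgebra C] [FiniteDimensional ℂ C]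
    (φ : FaithfulFunctional C) (T : B →ₗ[ℂ] C) : C →ₗ[ℂ] B :=
  ψ.toL2.symm.toLinearMap ∘ₗ
    LinearMap.adjoint (φ.toL2.toLinearMap ∘ₗ T ∘ₗ ψ.toL2.symm.toLinearMap) ∘ₗ
      φ.toL2.toLinearMap

lemma adjoint_spec {C : Type v} [CStarAlgebra C] [FiniteDimensional ℂ C]
    (φ : FaithfulFunctional C) (T : B →ₗ[ℂ] C) (b : B) (c : C) :
    φ (star (T b) * c) = ψ (star b * ψ.adjoint φ T c) := by
  have h := LinearMap.adjoint_inner_right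
    (φ.toL2.toLinearMap ∘ₗ T ∘ₗ ψ.toL2.symm.toLinearMap) (ψ.toL2 b) (φ.toL2 c)
  exact h.symm

/-- The identity map from `B ⊗ B` to the Hilbert space `L²(B, ψ) ⊗ L²(B, ψ)`. -/
def toL2Tensor : (B ⊗[ℂ] B) ≃ₗ[ℂ] (ψ.L2 ⊗[ℂ] ψ.L2) :=
  TensorProduct.congr ψ.toL2 ψ.toL2

/-- The comultiplication `m* : B → B ⊗ B`, the adjoint of the multiplication map
`m : B ⊗ B → B` with respect to the inner products induced by `ψ ⊗ ψ` and `ψ`. -/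
def comul : B →ₗ[ℂ] B ⊗[ℂ] B :=
  ψ.toL2Tensor.symm.toLinearMap ∘ₗ
    LinearMap.adjoint
      (ψ.toL2.toLinearMap ∘ₗ LinearMap.mul' ℂ B ∘ₗ ψ.toL2Tensor.symm.toLinearMap) ∘ₗ
      ψ.toL2.toLinearMap

lemma comul_spec (a b c : B) :
    ψ (star (a * b) * c) =
      inner ℂ (ψ.toL2 a ⊗ₜ[ℂ] ψ.toL2 b) (ψ.toL2Tensor (ψ.comul c)) := by
  have h := LinearMap.adjoint_inner_right
    (ψ.toL2.toLinearMap ∘ₗ LinearMap.mul' ℂ B ∘ₗ ψ.toL2Tensor.symm.toLinearMap)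
    (ψ.toL2 a ⊗ₜ[ℂ] ψ.toL2 b) (ψ.toL2 c)
  have e : ψ.toL2Tensor.symm (ψ.toL2 a ⊗ₜ[ℂ] ψ.toL2 b) = a ⊗ₜ[ℂ] b := by
    rw [LinearEquiv.symm_apply_eq]; rfl
  simp only [LinearMap.coe_comp, LinearEquiv.coe_coe, Function.comp_apply, e,
    LinearMap.mul'_apply] at h
  rw [inner_toL2] at h
  rw [← h]
  simp [comul]

/-- `(B, ψ)` is a quantum set: `m m* = Id`. -/
def IsQuantumSet : Prop :=
  LinearMap.mul' ℂ B ∘ₗ ψ.comul = LinearMap.id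

/-! ### Quantum graphs -/

/-- The Schur product `m (S ⊗ T) m*`. -/
def schur (S T : B →ₗ[ℂ] B) : B →ₗ[ℂ] B :=
  LinearMap.mul' ℂ B ∘ₗ TensorProduct.map S T ∘ₗ ψ.comul

/-- `A` is a quantum adjacency matrix: Schur-idempotent and `*`-preserving. -/
structure IsQuantumAdjacency (A : B →ₗ[ℂ] B) : Prop where
  schur_self : ψ.schur A A = A
  star_map : ∀ b, A (star b) = star (A b)

/-- `A` is a quantum graph on the quantum set `(B, ψ)`. -/
structure IsQuantumGraph (A : B →ₗ[ℂ] B) : Prop where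
  isQuantumSet : ψ.IsQuantumSet
  isQuantumAdjacency : ψ.IsQuantumAdjacency A

end FaithfulFunctional

/-- `φ` is an isomorphism from the quantum graph `A₁` on `(B₁, ψ₁)` to the quantum graph `A₂` on
`(B₂, ψ₂)`. -/
structure IsQuantumGraphIso {B₁ : Type u} {B₂ : Type v} [CStarAlgebra B₁] [CStarAlgebra B₂]
    (ψ₁ : FaithfulFunctional B₁) (A₁ : B₁ →ₗ[ℂ] B₁)
    (ψ₂ : FaithfulFunctional B₂) (A₂ : B₂ →ₗ[ℂ] B₂) (φ : B₁ ≃⋆ₐ[ℂ] B₂) : Prop where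
  functional : ∀ b, ψ₂ (φ b) = ψ₁ b
  adjacency : ∀ b, φ (A₁ b) = A₂ (φ b)

/-! ### The dual group -/

/-- The dual group of a (finite abelian) group: its characters with values in the unit circle. -/
abbrev DualGroup (G : Type v) [CommGroup G] : Type v := G →* Circle

instance DualGroup.instFinite (G : Type v) [CommGroup G] [Finite G] : Finite (DualGroup G) := by
  have hinj : Function.Injective
      (fun χ : DualGroup G => (Circle.toUnits.comp χ : G →* ℂˣ)) := by
    intro χ ξ h
    ext g
    have := congrArg Units.val (DFunLike.congr_fun h g)
    simpa using this
  exact Finite.of_injective _ hinj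

instance DualGroup.instFintype (G : Type v) [CommGroup G] [Finite G] : Fintype (DualGroup G) :=
  Fintype.ofFinite _

/-- The map `X_g = (1 / n) ∑ χ, conj (χ g) u_χ u_χ†`, where `u_χ† b = ψ (u_χ* b)` and `n = |G|`. -/
def FaithfulFunctional.X {B : Type u} [CStarAlgebra B] (ψ : FaithfulFunctional B)
    {G : Type v} [CommGroup G] [Fintype G] (u : DualGroup G → B) (g : G) : B →ₗ[ℂ] B :=
  (Fintype.card G : ℂ)⁻¹ • ∑ χ : DualGroup G,
    star (χ g : ℂ) • (ψ.toLinearMap ∘ₗ LinearMap.mulLeft ℂ (star (u χ))).smulRight (u χ)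

/-! ### Crossed products -/

/-- The crossed product `C ⋊ K` of a C*-algebra by an action `β` of a finite group. The function
`f` stands for the sum `∑ k, f k * u_k`. -/
def CrossedProduct {K : Type v} [Group K] {C : Type u} [CStarAlgebra C]
    (_β : K →* (C ≃⋆ₐ[ℂ] C)) : Type (max u v) := K → C

namespace CrossedProduct

variable {K : Type v} [Group K] {C : Type u} [CStarAlgebra C] (β : K →* (C ≃⋆ₐ[ℂ] C))

instance : AddCommGroup (CrossedProduct β) := inferInstanceAs (AddCommGroup (K → C))

instance : Module ℂ (CrossedProduct β) := inferInstanceAs (Module ℂ (K → C))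

variable {β}

/-- The coefficient of `u_k`. -/
def coeff (k : K) : CrossedProduct β →ₗ[ℂ] C := LinearMap.proj k

@[ext] lemma ext {f g : CrossedProduct β} (h : ∀ k, coeff k f = coeff k g) : f = g := funext h

open Classical in
/-- The element `c * u_k`. -/
def single (k : K) : C →ₗ[ℂ] CrossedProduct β := LinearMap.single ℂ (fun _ : K => C) k

open Classical in
lemma coeff_single (k l : K) (c : C) :
    coeff l (single k c : CrossedProduct β) = if l = k then c else 0 :=
  Pi.single_apply k c l

instance : One (CrossedProduct β) := ⟨single 1 1⟩

instance : Star (CrossedProduct β) := ⟨fun f => fun k => β k (star (coeff k⁻¹ f))⟩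

lemma one_def : (1 : CrossedProduct β) = single 1 1 := rfl

lemma coeff_star (k : K) (f : CrossedProduct β) :
    coeff k (star f) = β k (star (coeff k⁻¹ f)) := rfl

lemma beta_mul (k l : K) (c : C) : β k (β l c) = β (k * l) c := by
  rw [map_mul]; rfl

/-- The faithful representation of the crossed product by matrices over `C`. -/
def toMatrix : CrossedProduct β →ₗ[ℂ] CStarMatrix K K C where
  toFun f := CStarMatrix.ofMatrix (fun s t => β s⁻¹ (coeff (s * t⁻¹) f))
  map_add' f g := by
    ext s t
    exact (congrArg (β s⁻¹) (map_add (coeff _) f g)).trans (map_add (β s⁻¹) _ _)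
  map_smul' r f := by
    ext s t
    exact (congrArg (β s⁻¹) (map_smul (coeff _) r f)).trans (map_smul (β s⁻¹) r _)

lemma toMatrix_apply (f : CrossedProduct β) (s t : K) :
    toMatrix f s t = β s⁻¹ (coeff (s * t⁻¹) f) := rfl

lemma toMatrix_injective : Function.Injective (toMatrix : CrossedProduct β → _) := by
  intro f g h
  ext k
  have := congrFun (congrFun h k) 1
  rw [toMatrix_apply, toMatrix_apply] at this
  simpa using this

variable [Fintype K]

instance : Mul (CrossedProduct β) :=
  ⟨fun f g => fun k => ∑ l, coeff l f * β l (coeff (l⁻¹ * k) g)⟩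

lemma coeff_mul (k : K) (f g : CrossedProduct β) :
    coeff k (f * g) = ∑ l, coeff l f * β l (coeff (l⁻¹ * k) g) := rfl

lemma toMatrix_mul (f g : CrossedProduct β) : toMatrix (f * g) = toMatrix f * toMatrix g := by
  ext s t
  rw [CStarMatrix.mul_apply, toMatrix_apply, coeff_mul, map_sum]
  refine Fintype.sum_equiv ((Equiv.inv K).trans (Equiv.mulRight s)) _ _ fun l => ?_
  simp only [toMatrix_apply, map_mul, beta_mul, Equiv.trans_apply, Equiv.inv_apply,
    Equiv.coe_mulRight, mul_inv_rev, inv_inv, mul_assoc, mul_inv_cancel_left]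

open Classical in
lemma toMatrix_one : toMatrix (1 : CrossedProduct β) = 1 := by
  ext s t
  rw [toMatrix_apply, one_def, coeff_single, CStarMatrix.one_apply]
  by_cases h : s = t <;> simp [h, mul_inv_eq_one]

lemma toMatrix_star (f : CrossedProduct β) : toMatrix (star f) = star (toMatrix f) := by
  ext s t
  rw [CStarMatrix.star_apply]
  simp only [toMatrix_apply, coeff_star, beta_mul, ← map_star]
  simp

open Classical in
instance : Ring (CrossedProduct β) where
  left_distrib f g h := by apply toMatrix_injective; simp [toMatrix_mul, mul_add]
  right_distrib f g h := by apply toMatrix_injective; simp [toMatrix_mul, add_mul]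
  zero_mul f := by apply toMatrix_injective; simp [toMatrix_mul]
  mul_zero f := by apply toMatrix_injective; simp [toMatrix_mul]
  mul_assoc f g h := by apply toMatrix_injective; simp [toMatrix_mul, mul_assoc]
  one_mul f := by apply toMatrix_injective; simp [toMatrix_mul, toMatrix_one]
  mul_one f := by apply toMatrix_injective; simp [toMatrix_mul, toMatrix_one]
  neg_add_cancel f := neg_add_cancel f
  zsmul := fun n f => n • f
  nsmul := fun n f => n • f
  sub_eq_add_neg := sub_eq_add_neg
  nsmul_zero := AddMonoid.nsmul_zero
  nsmul_succ := AddMonoid.nsmul_succ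
  zsmul_zero' := SubNegMonoid.zsmul_zero'
  zsmul_succ' := SubNegMonoid.zsmul_succ'
  zsmul_neg' := SubNegMonoid.zsmul_neg'

instance : StarRing (CrossedProduct β) where
  star_involutive f := by apply toMatrix_injective; simp [toMatrix_star]
  star_mul f g := by apply toMatrix_injective; simp [toMatrix_star, toMatrix_mul]
  star_add f g := by apply toMatrix_injective; simp [toMatrix_star]

instance : StarModule ℂ (CrossedProduct β) where
  star_smul r f := by apply toMatrix_injective; simp [toMatrix_star]

open Classical in
instance : Algebra ℂ (CrossedProduct β) :=
  Algebra.ofModule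
    (fun r f g => by apply toMatrix_injective; simp [toMatrix_mul])
    (fun r f g => by apply toMatrix_injective; simp [toMatrix_mul])

instance [FiniteDimensional ℂ C] : FiniteDimensional ℂ (CrossedProduct β) :=
  inferInstanceAs (FiniteDimensional ℂ (K → C))

open Classical in
/-- The faithful representation of the crossed product as an algebra homomorphism. -/
def toMatrixHom : CrossedProduct β →ₐ[ℂ] CStarMatrix K K C :=
  AlgHom.ofLinearMap toMatrix toMatrix_one toMatrix_mul

open Classical in
/-- The C*-algebra structure of the crossed product. -/
instance [FiniteDimensional ℂ C] : CStarAlgebra (CrossedProduct β) :=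
  letI : PartialOrder C := CStarAlgebra.spectralOrder C
  letI : StarOrderedRing C := CStarAlgebra.spectralOrderedRing C
  letI : NormedRing (CrossedProduct β) :=
    NormedRing.induced (CrossedProduct β) (CStarMatrix K K C) toMatrixHom toMatrix_injective
  letI : NormedAlgebra ℂ (CrossedProduct β) :=
    NormedAlgebra.induced ℂ (CrossedProduct β) (CStarMatrix K K C) toMatrixHom
  { toCompleteSpace := FiniteDimensional.complete ℂ (CrossedProduct β)
    norm_mul_self_le := fun f => by
      change ‖toMatrix f‖ * ‖toMatrix f‖ ≤ ‖toMatrix (star f * f)‖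
      rw [toMatrix_mul, toMatrix_star]
      exact CStarRing.norm_mul_self_le _
    star_smul := star_smul
    norm_smul_le := NormedAlgebra.norm_smul_le }

variable [FiniteDimensional ℂ C]

/-- The functional `ψ_⋊ (∑ k, c_k u_k) = n ψ (c_1)` with `n = |K|` on the crossed product. -/
def functional (β : K →* (C ≃⋆ₐ[ℂ] C)) (ψ : FaithfulFunctional C) :
    FaithfulFunctional (CrossedProduct β) :=
  have key : ∀ f : CrossedProduct β, ψ (coeff 1 (star f * f)) =
      ∑ l, ψ (star (β l (coeff l⁻¹ f)) * β l (coeff l⁻¹ f)) := fun f => by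
    simp only [coeff_mul, map_sum, coeff_star, map_star, mul_one]
  have hcard : (0 : ℂ) < (Fintype.card K : ℂ) := by
    exact_mod_cast Fintype.card_pos
  { toLinearMap := (Fintype.card K : ℂ) • (ψ.toLinearMap ∘ₗ coeff 1)
    nonneg := fun f => by
      change 0 ≤ (Fintype.card K : ℂ) * ψ (coeff 1 (star f * f))
      rw [key]
      exact mul_nonneg hcard.le (Finset.sum_nonneg fun l _ => ψ.nonneg _)
    faithful := fun f h => by
      change (Fintype.card K : ℂ) * ψ (coeff 1 (star f * f)) = 0 at h
      rw [key, mul_eq_zero, or_iff_right hcard.ne',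
        Finset.sum_eq_zero_iff_of_nonneg fun l _ => ψ.nonneg _] at h
      ext k
      have := ψ.faithful _ (h k⁻¹ (Finset.mem_univ _))
      rw [inv_inv] at this
      simpa using this }

/-- The map `E (∑ k, c_k u_k) = n c_1` with `n = |K|`. -/
def E (β : K →* (C ≃⋆ₐ[ℂ] C)) : CrossedProduct β →ₗ[ℂ] C :=
  (Fintype.card K : ℂ) • coeff 1

end CrossedProduct

/-! ### Voltage quantum graphs and derived quantum graphs -/

/-- `A` is a voltage quantum graph on the quantum set `(C, ψ)` with respect to the action `β` of
the dual group of `G` on this quantum set. -/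
structure IsVoltageQuantumGraph {C : Type u} [CStarAlgebra C] [FiniteDimensional ℂ C]
    {G : Type v} [CommGroup G] (ψ : FaithfulFunctional C)
    (β : DualGroup G →* (C ≃⋆ₐ[ℂ] C)) (A : G → C →ₗ[ℂ] C) : Prop where
  isQuantumSet : ψ.IsQuantumSet
  functional_invariant : ∀ χ c, ψ (β χ c) = ψ c
  isQuantumAdjacency : ∀ g, ψ.IsQuantumAdjacency (A g)
  commute : ∀ g χ c, A g (β χ c) = β χ (A g c)

/-- The derived quantum graph `∑ g, m (X_g ⊗ E* A_g E) m*` on the crossed product. -/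
def derivedQuantumGraph {C : Type u} [CStarAlgebra C] [FiniteDimensional ℂ C]
    {G : Type v} [CommGroup G] [Fintype G] (ψ : FaithfulFunctional C)
    (β : DualGroup G →* (C ≃⋆ₐ[ℂ] C)) (A : G → C →ₗ[ℂ] C) :
    CrossedProduct β →ₗ[ℂ] CrossedProduct β :=
  let ψc := CrossedProduct.functional β ψ
  ∑ g : G, ψc.schur (ψc.X (fun χ : DualGroup G => CrossedProduct.single χ 1) g)
    (ψc.adjoint ψ (CrossedProduct.E β) ∘ₗ A g ∘ₗ CrossedProduct.E β)

/-! ### Fixed point algebras -/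

/-- The fixed point algebra of a group action on a C*-algebra. -/
def fixedPointAlgebra {G : Type v} [Group G] {B : Type u} [CStarAlgebra B]
    (α : G →* (B ≃⋆ₐ[ℂ] B)) : StarSubalgebra ℂ B where
  carrier := {b | ∀ g, α g b = b}
  mul_mem' ha hb g := by rw [map_mul, ha g, hb g]
  one_mem' g := map_one _
  add_mem' ha hb g := by rw [map_add, ha g, hb g]
  zero_mem' g := map_zero _
  algebraMap_mem' r g := by
    rw [Algebra.algebraMap_eq_smul_one, map_smul, map_one]
  star_mem' ha g := by rw [map_star, ha g]

lemma mem_fixedPointAlgebra {G : Type v} [Group G] {B : Type u} [CStarAlgebra B]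
    {α : G →* (B ≃⋆ₐ[ℂ] B)} {b : B} : b ∈ fixedPointAlgebra α ↔ ∀ g, α g b = b := Iff.rfl

section FixedPoints

variable {G : Type v} [Group G] {B : Type u} [CStarAlgebra B] [FiniteDimensional ℂ B]
  (α : G →* (B ≃⋆ₐ[ℂ] B))

instance : FiniteDimensional ℂ (fixedPointAlgebra α) :=
  FiniteDimensional.finiteDimensional_submodule (fixedPointAlgebra α).toSubalgebra.toSubmodule

instance fixedPointAlgebra.instIsClosed : IsClosed (fixedPointAlgebra α : Set B) :=
  Submodule.closed_of_finiteDimensional (fixedPointAlgebra α).toSubalgebra.toSubmodule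

/-- The functional `(1 / |G|) ψ` restricted to the fixed point algebra. -/
def FaithfulFunctional.restrictFixed [Fintype G] (ψ : FaithfulFunctional B) :
    FaithfulFunctional (fixedPointAlgebra α) :=
  have hcard : (0 : ℂ) < (Fintype.card G : ℂ)⁻¹ := by
    rw [inv_pos]; exact_mod_cast Fintype.card_pos
  { toLinearMap := (Fintype.card G : ℂ)⁻¹ •
      (ψ.toLinearMap ∘ₗ (fixedPointAlgebra α).subtype.toLinearMap)
    nonneg := fun b => mul_nonneg hcard.le (ψ.nonneg (b : B))
    faithful := fun b h => by
      have h' : (Fintype.card G : ℂ)⁻¹ * ψ (star (b : B) * (b : B)) = 0 := h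
      rw [mul_eq_zero, or_iff_right hcard.ne'] at h'
      exact Subtype.ext (ψ.faithful _ h') }

end FixedPoints

section DualAction

variable {G : Type v} [CommGroup G] {B : Type u} [CStarAlgebra B]
  (α : G →* (B ≃⋆ₐ[ℂ] B)) (u : DualGroup G →* unitary B)

/-- The relation `α_g (u_χ) = χ(g) u_χ` for a unitary representation of the dual group. -/
def IsEigenRepresentation : Prop :=
  ∀ (g : G) (χ : DualGroup G), α g (u χ : B) = (χ g : ℂ) • (u χ : B)

variable {α u}

lemma IsEigenRepresentation.conj_mem (hu : IsEigenRepresentation α u) (χ : DualGroup G)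
    {b : B} (hb : b ∈ fixedPointAlgebra α) :
    Unitary.conjStarAlgAut ℂ B (u χ) b ∈ fixedPointAlgebra α := by
  intro g
  have hχ : star (χ g : ℂ) * (χ g : ℂ) = 1 := by
    rw [mul_comm, Complex.star_def, Complex.mul_conj, Circle.normSq_coe]; simp
  rw [Unitary.conjStarAlgAut_apply]
  simp only [map_mul, map_star, hb g, hu g χ, star_smul, smul_mul_assoc, mul_smul_comm, smul_smul,
    hχ, one_smul]

/-- The action `χ ↦ Ad(u_χ)` of the dual group on the fixed point algebra. -/
def IsEigenRepresentation.dualAction (hu : IsEigenRepresentation α u) :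
    DualGroup G →* (fixedPointAlgebra α ≃⋆ₐ[ℂ] fixedPointAlgebra α) where
  toFun χ :=
    { toFun := fun b => ⟨Unitary.conjStarAlgAut ℂ B (u χ) b, hu.conj_mem χ b.2⟩
      invFun := fun b => ⟨Unitary.conjStarAlgAut ℂ B (u χ⁻¹) b, hu.conj_mem χ⁻¹ b.2⟩
      left_inv := fun b => Subtype.ext <| by
        change Unitary.conjStarAlgAut ℂ B (u χ⁻¹) (Unitary.conjStarAlgAut ℂ B (u χ) b) = b
        rw [← Unitary.conjStarAlgAut_mul_apply, ← map_mul]; simp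
      right_inv := fun b => Subtype.ext <| by
        change Unitary.conjStarAlgAut ℂ B (u χ) (Unitary.conjStarAlgAut ℂ B (u χ⁻¹) b) = b
        rw [← Unitary.conjStarAlgAut_mul_apply, ← map_mul]; simp
      map_mul' := fun a b => Subtype.ext (map_mul _ (a : B) b)
      map_add' := fun a b => Subtype.ext (map_add _ (a : B) b)
      map_star' := fun a => Subtype.ext (map_star _ (a : B))
      map_smul' := fun r a => Subtype.ext (map_smul _ r (a : B)) }
  map_one' := by ext b; simp
  map_mul' χ ξ := by
    ext b
    exact (congrArg (fun w => Unitary.conjStarAlgAut ℂ B w (b : B)) (map_mul u χ ξ)).trans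
      (Unitary.conjStarAlgAut_mul_apply _ _ _)

lemma IsEigenRepresentation.coe_dualAction (hu : IsEigenRepresentation α u) (χ : DualGroup G)
    (b : fixedPointAlgebra α) :
    (hu.dualAction χ b : B) = (u χ : B) * b * star (u χ : B) := rfl

end DualAction

end

noncomputable section

/-! Write S • T for the Schur product `ψ.schur S T` and |a⟩⟨b| for `ψ.rankOne a b`. Rank one
operators span End(B) and satisfy |a⟩⟨b| • |c⟩⟨d| = |ac⟩⟨bd| (`schur_rankOne`). Hence • is
associative, with unit |1⟩⟨1|, and End(B) becomes a copy of B ⊗ Bᵒᵖ. A quantum set is one for which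
Id • Id = Id, and a quantum adjacency matrix is a `*`-preserving Schur idempotent, so the theorem
turns into algebra with idempotents.

By character orthogonality the X_g are mutually orthogonal Schur idempotents with sum |1⟩⟨1|
(`schur_X_X`, `sum_X`). They Schur-commute with every operator that commutes with all Ad(u_χ)
(`schur_X_comm`), in particular with A and with each α_h.

Precomposing with the orbit sum B → B^α and postcomposing with the inclusion embeds End(B^α) into
End(B) compatibly with • (`extendFixed_schur`), so every identity on B^α can be checked in B. There
Id becomes ∑ α_h, a sum of orthogonal idempotents (`schur_action_action`), and Ã_g becomes ∑_h
X_{gh⁻¹} • (A α_h), again a sum of orthogonal idempotents (`extendFixed_schur_X`). Multiplying by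
X_g keeps only h = 1, namely X_g • A, and summing over g recovers A (`sum_schur_X_extendFixed`).

Finally, Fourier decomposition along the u_χ identifies B with the crossed product
(`crossedProductEquiv`). This carries the orbit sum to E_⋊, the inclusion to E_⋊*, and X_g to X_g,
so the derived graph is the transport of ∑_g X_g • ext(Ã_g) = A. -/

/-- A `*`-isomorphism as a linear equivalence. -/
def StarAlgEquiv.asLinearEquiv {B : Type u} {D : Type v} [CStarAlgebra B] [CStarAlgebra D]
    (γ : B ≃⋆ₐ[ℂ] D) : B ≃ₗ[ℂ] D :=
  { γ.toEquiv with
    map_add' := map_add γ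
    map_smul' := map_smul γ }

/-! ### Schur product calculus through rank one operators. -/

namespace FaithfulFunctional

variable {B : Type u} [CStarAlgebra B] (ψ : FaithfulFunctional B)

/-- The rank one operator `x ↦ ψ (b* x) a`. -/
def rankOne (a b : B) : B →ₗ[ℂ] B :=
  (ψ.toLinearMap ∘ₗ LinearMap.mulLeft ℂ (star b)).smulRight a

lemma rankOne_apply (a b x : B) : ψ.rankOne a b x = ψ (star b * x) • a := rfl

/-- The linear map `x ↦ T(x*)*`. -/
def starConj (T : B →ₗ[ℂ] B) : B →ₗ[ℂ] B where
  toFun x := star (T (star x))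
  map_add' x y := by simp
  map_smul' r x := by simp

lemma starConj_apply (T : B →ₗ[ℂ] B) (x : B) : starConj T x = star (T (star x)) := rfl

variable [FiniteDimensional ℂ B]

lemma exists_eq_sum_rankOne (T : B →ₗ[ℂ] B) :
    ∃ (n : ℕ) (a b : Fin n → B), T = ∑ i, ψ.rankOne (a i) (b i) := by
  let e := stdOrthonormalBasis ℂ ψ.L2
  refine ⟨_, fun i => T (ψ.toL2.symm (e i)), fun i => ψ.toL2.symm (e i), ?_⟩
  ext x
  have h : ∑ i, inner ℂ (e i) (ψ.toL2 x) • e i = ψ.toL2 x := e.sum_repr' (ψ.toL2 x)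
  have h2 := congrArg (fun y => T (ψ.toL2.symm y)) h
  simp only [map_sum, map_smul, LinearEquiv.symm_apply_apply] at h2
  rw [LinearMap.sum_apply, ← h2]
  rfl

lemma linearMap_induction {p : (B →ₗ[ℂ] B) → Prop} (T : B →ₗ[ℂ] B)
    (rankOne : ∀ a b, p (ψ.rankOne a b)) (zero : p 0) (add : ∀ S T, p S → p T → p (S + T)) :
    p T := by
  obtain ⟨n, a, b, rfl⟩ := ψ.exists_eq_sum_rankOne T
  exact Finset.sum_induction _ p add zero fun i _ => rankOne _ _

/-- The Schur product as a bilinear map. -/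
def schurBilin : (B →ₗ[ℂ] B) →ₗ[ℂ] (B →ₗ[ℂ] B) →ₗ[ℂ] (B →ₗ[ℂ] B) :=
  LinearMap.mk₂ ℂ ψ.schur
    (fun S S' T => by simp [schur, TensorProduct.map_add_left, LinearMap.add_comp,
      LinearMap.comp_add])
    (fun r S T => by simp [schur, TensorProduct.map_smul_left, LinearMap.smul_comp,
      LinearMap.comp_smul])
    (fun S T T' => by simp [schur, TensorProduct.map_add_right, LinearMap.add_comp,
      LinearMap.comp_add])
    (fun r S T => by simp [schur, TensorProduct.map_smul_right, LinearMap.smul_comp,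
      LinearMap.comp_smul])

lemma schur_zero_left (T : B →ₗ[ℂ] B) : ψ.schur 0 T = 0 := ψ.schurBilin.map_zero₂ T

lemma schur_zero_right (S : B →ₗ[ℂ] B) : ψ.schur S 0 = 0 := (ψ.schurBilin S).map_zero

lemma schur_add_left (S S' T : B →ₗ[ℂ] B) :
    ψ.schur (S + S') T = ψ.schur S T + ψ.schur S' T := ψ.schurBilin.map_add₂ S S' T

lemma schur_add_right (S T T' : B →ₗ[ℂ] B) :
    ψ.schur S (T + T') = ψ.schur S T + ψ.schur S T' := (ψ.schurBilin S).map_add T T'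

lemma schur_smul_left (r : ℂ) (S T : B →ₗ[ℂ] B) :
    ψ.schur (r • S) T = r • ψ.schur S T := ψ.schurBilin.map_smul₂ r S T

lemma schur_smul_right (r : ℂ) (S T : B →ₗ[ℂ] B) :
    ψ.schur S (r • T) = r • ψ.schur S T := (ψ.schurBilin S).map_smul r T

lemma schur_sum_left {ι : Type*} (s : Finset ι) (S : ι → B →ₗ[ℂ] B) (T : B →ₗ[ℂ] B) :
    ψ.schur (∑ i ∈ s, S i) T = ∑ i ∈ s, ψ.schur (S i) T :=
  LinearMap.map_sum₂ ψ.schurBilin s S T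

lemma schur_sum_right {ι : Type*} (s : Finset ι) (S : B →ₗ[ℂ] B) (T : ι → B →ₗ[ℂ] B) :
    ψ.schur S (∑ i ∈ s, T i) = ∑ i ∈ s, ψ.schur S (T i) :=
  map_sum (ψ.schurBilin S) T s

/-- This is the defining property of m*: ψ((bd)* x) = ⟨b ⊗ d, m* x⟩. All later identities for the
Schur product reduce to it by linearity. -/
lemma schur_rankOne (a b c d : B) :
    ψ.schur (ψ.rankOne a b) (ψ.rankOne c d) = ψ.rankOne (a * c) (b * d) := by
  have key : ∀ t : B ⊗[ℂ] B,
      LinearMap.mul' ℂ B (TensorProduct.map (ψ.rankOne a b) (ψ.rankOne c d) t) =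
        inner ℂ (ψ.toL2 b ⊗ₜ[ℂ] ψ.toL2 d) (ψ.toL2Tensor t) • (a * c) := by
    intro t
    induction t with
    | zero => simp
    | add s t hs ht => rw [map_add, map_add, map_add, inner_add_right, hs, ht, add_smul]
    | tmul x y =>
      have h : ψ.toL2Tensor (x ⊗ₜ[ℂ] y) = ψ.toL2 x ⊗ₜ[ℂ] ψ.toL2 y := rfl
      rw [h, TensorProduct.inner_tmul, inner_toL2, inner_toL2, TensorProduct.map_tmul,
        LinearMap.mul'_apply, rankOne_apply, rankOne_apply, smul_mul_smul_comm]
  ext x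
  rw [rankOne_apply, comul_spec]
  exact key _

lemma schur_assoc (R S T : B →ₗ[ℂ] B) :
    ψ.schur (ψ.schur R S) T = ψ.schur R (ψ.schur S T) := by
  induction R using ψ.linearMap_induction with
  | zero => simp only [schur_zero_left]
  | add R R' h h' => simp only [schur_add_left, h, h']
  | rankOne a b =>
  induction S using ψ.linearMap_induction with
  | zero => simp only [schur_zero_left, schur_zero_right]
  | add R R' h h' => simp only [schur_add_left, schur_add_right, h, h']
  | rankOne c d =>
  induction T using ψ.linearMap_induction with
  | zero => simp only [schur_zero_right]
  | add R R' h h' => simp only [schur_add_right, h, h']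
  | rankOne x y => simp only [schur_rankOne, mul_assoc]

lemma schur_rankOne_left (a b : B) (T : B →ₗ[ℂ] B) (x : B) :
    ψ.schur (ψ.rankOne a b) T x = a * T (star b * x) := by
  induction T using ψ.linearMap_induction with
  | zero => simp [schur_zero_right]
  | add S T hS hT => simp [schur_add_right, hS, hT, mul_add]
  | rankOne c d => simp [schur_rankOne, rankOne_apply, mul_assoc]

/-- Here b* acts next to x from the wrong side: for T = |c⟩⟨d| the coefficient is ψ(b* d* x). Since
ψ need not be a trace, b* must commute past its argument under ψ. -/
lemma schur_rankOne_right (T : B →ₗ[ℂ] B) (a b : B)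
    (hb : ∀ x, ψ (star b * x) = ψ (x * star b)) (x : B) :
    ψ.schur T (ψ.rankOne a b) x = T (x * star b) * a := by
  induction T using ψ.linearMap_induction with
  | zero => simp [schur_zero_left]
  | add S T hS hT => simp [schur_add_left, hS, hT, add_mul]
  | rankOne c d => simp [schur_rankOne, rankOne_apply, mul_assoc, hb]

lemma schur_rankOne_one_left (T : B →ₗ[ℂ] B) : ψ.schur (ψ.rankOne 1 1) T = T := by
  ext x
  simp [schur_rankOne_left]

/-- This stands in for the modular automorphism of the possibly non-tracial ψ. The witness is the
adjoint of right multiplication by b, applied to 1. -/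
lemma exists_modular (b : B) : ∃ c, ∀ x, ψ (x * b) = ψ (star c * x) := by
  refine ⟨ψ.adjoint ψ (LinearMap.mulRight ℂ b) 1, fun x => ?_⟩
  have h := congrArg star (ψ.adjoint_spec ψ (LinearMap.mulRight ℂ b) x 1)
  rw [← map_star, ← map_star] at h
  simpa using h

omit [FiniteDimensional ℂ B] in
lemma starConj_rankOne {b c : B} (h : ∀ x, ψ (x * b) = ψ (star c * x)) (a : B) :
    starConj (ψ.rankOne a b) = ψ.rankOne (star a) c := by
  ext x
  rw [starConj_apply, rankOne_apply, rankOne_apply, star_smul, ← map_star, ← h]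
  simp

/-- The order reverses because `star` reverses the left legs, while the modular substitution b ↦ b'
reverses the right legs. -/
lemma starConj_schur (S T : B →ₗ[ℂ] B) :
    starConj (ψ.schur S T) = ψ.schur (starConj T) (starConj S) := by
  have hadd (S T : B →ₗ[ℂ] B) : starConj (S + T) = starConj S + starConj T := by
    ext x; simp [starConj_apply]
  have hzero : starConj (0 : B →ₗ[ℂ] B) = 0 := by ext x; simp [starConj_apply]
  induction S using ψ.linearMap_induction with
  | zero => simp only [schur_zero_left, hzero, schur_zero_right]
  | add R R' h h' => simp only [schur_add_left, schur_add_right, hadd, h, h']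
  | rankOne a b =>
  induction T using ψ.linearMap_induction with
  | zero => simp only [schur_zero_left, schur_zero_right, hzero]
  | add R R' h h' => simp only [schur_add_left, schur_add_right, hadd, h, h']
  | rankOne c d =>
    obtain ⟨b', hb⟩ := ψ.exists_modular b
    obtain ⟨d', hd⟩ := ψ.exists_modular d
    have hbd : ∀ x, ψ (x * (b * d)) = ψ (star (d' * b') * x) := fun x => by
      rw [← mul_assoc, hd, ← mul_assoc, hb, star_mul, mul_assoc]
    rw [schur_rankOne, ψ.starConj_rankOne hb, ψ.starConj_rankOne hd, ψ.starConj_rankOne hbd,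
      schur_rankOne, star_mul]

/-- A map into the Schur algebra of another quantum space that is multiplicative on rank one
operators is multiplicative. -/
lemma map_schur_of_rankOne {D : Type v} [CStarAlgebra D] [FiniteDimensional ℂ D]
    (φ : FaithfulFunctional D) (F : (B →ₗ[ℂ] B) →+ (D →ₗ[ℂ] D))
    (hF : ∀ a b c d, F (ψ.rankOne (a * c) (b * d)) =
      φ.schur (F (ψ.rankOne a b)) (F (ψ.rankOne c d))) (S T : B →ₗ[ℂ] B) :
    F (ψ.schur S T) = φ.schur (F S) (F T) := by
  induction S using ψ.linearMap_induction with
  | zero => simp only [schur_zero_left, map_zero]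
  | add R R' h h' => simp only [schur_add_left, map_add, h, h']
  | rankOne a b =>
  induction T using ψ.linearMap_induction with
  | zero => simp only [schur_zero_right, map_zero]
  | add R R' h h' => simp only [schur_add_right, map_add, h, h']
  | rankOne c d => rw [schur_rankOne, hF]

/-- Precomposition moves γ⁻¹ onto the right leg, |a⟩⟨b| γ = |a⟩⟨γ⁻¹ b|, which uses invariance of ψ.
Postcomposition acts on the left leg and needs no invariance. -/
lemma schur_comp_starAlgEquiv (γ : B ≃⋆ₐ[ℂ] B) (hγ : ∀ b, ψ (γ b) = ψ b) (S T : B →ₗ[ℂ] B) :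
    ψ.schur S T ∘ₗ γ.asLinearEquiv.toLinearMap = ψ.schur (S ∘ₗ γ.asLinearEquiv.toLinearMap) (T ∘ₗ γ.asLinearEquiv.toLinearMap) := by
  have h (a b : B) : ψ.rankOne a b ∘ₗ γ.asLinearEquiv.toLinearMap = ψ.rankOne a (γ.symm b) := by
    ext x
    change ψ (star b * γ x) • a = ψ (star (γ.symm b) * x) • a
    rw [← hγ (star (γ.symm b) * x), map_mul γ, StarHomClass.map_star γ, γ.apply_symm_apply]
  refine ψ.map_schur_of_rankOne ψ
    (AddMonoidHom.mk' (fun S => S ∘ₗ γ.asLinearEquiv.toLinearMap) fun S T => LinearMap.add_comp _ _ _) ?_ S T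
  intro a b c d
  simp only [AddMonoidHom.mk'_apply, h, schur_rankOne, map_mul]

lemma starAlgEquiv_comp_schur (γ : B ≃⋆ₐ[ℂ] B) (S T : B →ₗ[ℂ] B) :
    γ.asLinearEquiv.toLinearMap ∘ₗ ψ.schur S T = ψ.schur (γ.asLinearEquiv.toLinearMap ∘ₗ S) (γ.asLinearEquiv.toLinearMap ∘ₗ T) := by
  have h (a b : B) : γ.asLinearEquiv.toLinearMap ∘ₗ ψ.rankOne a b = ψ.rankOne (γ a) b := by
    ext x
    exact map_smul γ _ _
  refine ψ.map_schur_of_rankOne ψ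
    (AddMonoidHom.mk' (fun S => γ.asLinearEquiv.toLinearMap ∘ₗ S) fun S T => LinearMap.comp_add _ _ _) ?_ S T
  intro a b c d
  simp only [AddMonoidHom.mk'_apply, h, schur_rankOne, map_mul]

lemma schur_conj {D : Type v} [CStarAlgebra D] [FiniteDimensional ℂ D]
    (φ : FaithfulFunctional D) (γ : B ≃⋆ₐ[ℂ] D) (hγ : ∀ b, φ (γ b) = ψ b) (S T : B →ₗ[ℂ] B) :
    γ.asLinearEquiv.conj (ψ.schur S T) =
      φ.schur (γ.asLinearEquiv.conj S) (γ.asLinearEquiv.conj T) := by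
  have h (a b : B) : γ.asLinearEquiv.conj (ψ.rankOne a b) = φ.rankOne (γ a) (γ b) := by
    ext x
    have : φ (star (γ b) * x) = ψ (star b * γ.symm x) := by
      rw [← hγ, map_mul γ, StarHomClass.map_star γ, γ.apply_symm_apply]
    rw [rankOne_apply, this]
    exact map_smul γ _ _
  refine ψ.map_schur_of_rankOne φ
    (AddMonoidHom.mk' (fun S => γ.asLinearEquiv.conj S) fun S T => map_add _ _ _) ?_ S T
  intro a b c d
  simp only [AddMonoidHom.mk'_apply, h, schur_rankOne, map_mul]

lemma schur_id_id_iff : ψ.IsQuantumSet ↔ ψ.schur LinearMap.id LinearMap.id = LinearMap.id := by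
  rw [IsQuantumSet, schur, TensorProduct.map_id, LinearMap.id_comp]

end FaithfulFunctional

/-- Transport of a quantum graph structure along an isomorphism. -/
lemma IsQuantumGraphIso.isQuantumGraph {B : Type u} {D : Type v} [CStarAlgebra B]
    [CStarAlgebra D] [FiniteDimensional ℂ B] [FiniteDimensional ℂ D]
    {ψ : FaithfulFunctional B} {A : B →ₗ[ℂ] B} {φ : FaithfulFunctional D} {A' : D →ₗ[ℂ] D}
    {γ : B ≃⋆ₐ[ℂ] D} (hγ : IsQuantumGraphIso ψ A φ A' γ) (hA : ψ.IsQuantumGraph A) :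
    φ.IsQuantumGraph A' := by
  have hA' : A' = γ.asLinearEquiv.conj A := by
    ext x
    exact (congrArg A' (γ.apply_symm_apply x).symm).trans (hγ.adjacency _).symm
  refine ⟨?_, ⟨?_, fun x => ?_⟩⟩
  · rw [FaithfulFunctional.schur_id_id_iff]
    have h := ψ.schur_conj φ γ hγ.functional LinearMap.id LinearMap.id
    rw [ψ.schur_id_id_iff.1 hA.isQuantumSet, LinearEquiv.conj_id] at h
    exact h.symm
  · rw [hA', ← ψ.schur_conj φ γ hγ.functional, hA.isQuantumAdjacency.schur_self]
  · obtain ⟨b, rfl⟩ : ∃ b, γ b = x := ⟨γ.symm x, γ.apply_symm_apply x⟩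
    rw [← map_star, ← hγ.adjacency, ← hγ.adjacency, hA.isQuantumAdjacency.star_map, map_star]


/-! ### Orthogonality of characters -/

namespace DualGroup

variable {G : Type v} [CommGroup G] [Fintype G]

lemma exists_apply_ne_one {g : G} (hg : g ≠ 1) : ∃ χ : DualGroup G, χ g ≠ 1 := by
  have : NeZero (Monoid.exponent G) := ⟨Monoid.exponent_ne_zero_of_finite⟩
  obtain ⟨f, hf⟩ := CommGroup.exists_apply_ne_one_of_hasEnoughRootsOfUnity G Circle hg
  exact ⟨(Units.coeHom Circle).comp f, fun h => hf (Units.ext h)⟩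

omit [Fintype G] in
lemma star_coe (χ : DualGroup G) (g : G) : star (χ g : ℂ) = (χ⁻¹ g : Circle) := by
  rw [MonoidHom.inv_apply, Circle.coe_inv_eq_conj]; rfl

omit [Fintype G] in
lemma star_coe' (χ : DualGroup G) (g : G) : star (χ g : ℂ) = (χ g⁻¹ : Circle) := by
  rw [map_inv, Circle.coe_inv_eq_conj]; rfl

open Classical in
lemma sum_apply_group (χ : DualGroup G) :
    ∑ g : G, (χ g : ℂ) = if χ = 1 then (Fintype.card G : ℂ) else 0 := by
  split_ifs with h
  · simp [h]
  · obtain ⟨g, hg⟩ : ∃ g, χ g ≠ 1 := by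
      by_contra! hc
      exact h (MonoidHom.ext hc)
    -- Translation by g permutes the summands, so the sum absorbs the factor χ(g) ≠ 1 and must
    -- vanish.
    have h1 : (χ g : ℂ) * ∑ x : G, (χ x : ℂ) = ∑ x : G, (χ x : ℂ) := by
      rw [Finset.mul_sum]
      exact Fintype.sum_equiv (Equiv.mulLeft g) _ _ fun x => by simp
    refine eq_zero_of_mul_eq_self_left (fun h => hg ?_) h1
    exact Circle.ext h

lemma card_eq : (Fintype.card (DualGroup G) : ℂ) = Fintype.card G := by
  have : NeZero (Monoid.exponent G) := ⟨Monoid.exponent_ne_zero_of_finite⟩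
  have h := CommGroup.card_monoidHom_of_hasEnoughRootsOfUnity G Circle
  -- The count is for homomorphisms into the units of `Circle`; as `Circle` is a group, these are
  -- the same as characters.
  have e : DualGroup G ≃ (G →* Circleˣ) := (toUnits.monoidHomCongrRight : _ ≃* _).toEquiv
  rw [← Nat.card_congr e] at h
  rw [← Nat.card_eq_fintype_card, ← Nat.card_eq_fintype_card, h]

open Classical in
lemma sum_apply_dual (g : G) :
    ∑ χ : DualGroup G, (χ g : ℂ) = if g = 1 then (Fintype.card G : ℂ) else 0 := by
  split_ifs with h
  · simp only [h, map_one, Circle.coe_one, Finset.sum_const, nsmul_eq_mul, mul_one,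
      Finset.card_univ]
    exact card_eq
  · obtain ⟨ξ, hξ⟩ := exists_apply_ne_one h
    have h1 : (ξ g : ℂ) * ∑ χ : DualGroup G, (χ g : ℂ) = ∑ χ : DualGroup G, (χ g : ℂ) := by
      rw [Finset.mul_sum]
      exact Fintype.sum_equiv (Equiv.mulLeft ξ) _ _ fun x => by simp
    refine eq_zero_of_mul_eq_self_left (fun h => hξ ?_) h1
    exact Circle.ext h

end DualGroup

/-! ### The Schur projections `X_g` -/

namespace FaithfulFunctional

variable {B : Type u} [CStarAlgebra B] [FiniteDimensional ℂ B] (ψ : FaithfulFunctional B)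
  {G : Type v} [CommGroup G] [Fintype G] (u : DualGroup G →* unitary B)

omit [FiniteDimensional ℂ B] in
lemma X_eq (v : DualGroup G → B) (g : G) :
    ψ.X v g = (Fintype.card G : ℂ)⁻¹ • ∑ χ : DualGroup G,
      star (χ g : ℂ) • ψ.rankOne (v χ) (v χ) := rfl

-- The product of the χ and ξ terms is supported on u_{χξ}. With η = χξ fixed, the remaining sum
-- over χ of χ(g⁻¹h) is n or 0.
open Classical in
lemma schur_X_X (g h : G) :
    ψ.schur (ψ.X (fun χ => (u χ : B)) g) (ψ.X (fun χ => (u χ : B)) h) =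
      if g = h then ψ.X (fun χ => (u χ : B)) h else 0 := by
  have h1 : ψ.schur (∑ χ : DualGroup G, star (χ g : ℂ) • ψ.rankOne (u χ : B) (u χ))
      (∑ χ : DualGroup G, star (χ h : ℂ) • ψ.rankOne (u χ : B) (u χ)) =
      (∑ χ : DualGroup G, (χ (g⁻¹ * h) : ℂ)) •
        ∑ χ : DualGroup G, star (χ h : ℂ) • ψ.rankOne (u χ : B) (u χ) := by
    rw [schur_sum_left, Finset.sum_smul]
    refine Finset.sum_congr rfl fun χ _ => ?_
    rw [schur_sum_right, Finset.smul_sum]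
    refine Fintype.sum_equiv (Equiv.mulLeft χ) _ _ fun ξ => ?_
    have h2 : star (ξ h : ℂ) * star (χ g : ℂ) =
        (χ (g⁻¹ * h) : ℂ) * star ((χ * ξ) h : ℂ) := by
      simp only [DualGroup.star_coe', ← Circle.coe_mul]
      congr 1
      simp only [MonoidHom.mul_apply, map_mul, map_inv]
      rw [mul_assoc, mul_inv (χ h), mul_inv_cancel_left, mul_comm]
    rw [schur_smul_left, schur_smul_right, schur_rankOne, smul_smul, smul_smul, mul_comm,
      Equiv.coe_mulLeft, ← h2, map_mul]
    rfl
  rw [X_eq, X_eq, schur_smul_left, schur_smul_right, h1, DualGroup.sum_apply_dual]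
  by_cases hg : g = h
  · rw [if_pos hg, if_pos (inv_mul_eq_one.2 hg), smul_smul, smul_smul, mul_assoc,
      inv_mul_cancel₀ (by simp), mul_one]
  · rw [if_neg hg, if_neg (fun h => hg (inv_mul_eq_one.1 h)), zero_smul, smul_zero, smul_zero]

omit [FiniteDimensional ℂ B] in
lemma sum_X : ∑ g : G, ψ.X (fun χ => (u χ : B)) g = ψ.rankOne 1 1 := by
  classical
  simp only [X_eq]
  rw [← Finset.smul_sum, Finset.sum_comm]
  simp only [← Finset.sum_smul, DualGroup.star_coe, DualGroup.sum_apply_group, inv_eq_one]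
  simp [smul_smul]

variable {ψ u}

omit [FiniteDimensional ℂ B] [Fintype G] in
lemma coe_unitary_inv (χ : DualGroup G) : (u χ⁻¹ : B) = star (u χ : B) := by
  rw [map_inv]; rfl

variable (huψ : ∀ χ b, ψ (Unitary.conjStarAlgAut ℂ B (u χ) b) = ψ b)
include huψ

omit [FiniteDimensional ℂ B] [Fintype G] in
lemma map_unitary_mul (χ : DualGroup G) (x : B) : ψ ((u χ : B) * x) = ψ (x * u χ) := by
  have h := huψ χ (x * u χ)
  rw [Unitary.conjStarAlgAut_apply, mul_assoc, mul_assoc, Unitary.mul_star_self_of_mem (u χ).2,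
    mul_one] at h
  exact h

omit [FiniteDimensional ℂ B] [Fintype G] in
lemma map_star_unitary_mul (χ : DualGroup G) (x : B) :
    ψ (star (u χ : B) * x) = ψ (x * star (u χ : B)) := by
  have h := huψ χ (star (u χ : B) * x)
  rw [Unitary.conjStarAlgAut_apply, ← mul_assoc, Unitary.mul_star_self_of_mem (u χ).2,
    one_mul] at h
  exact h.symm

/-- Schur multiplication by |u_χ⟩⟨u_χ| gives u_χ T(u_χ* x) on the left and T(x u_χ*) u_χ on the
right. They agree because T commutes with Ad(u_χ). -/
lemma schur_X_comm {T : B →ₗ[ℂ] B}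
    (hT : ∀ χ b, Unitary.conjStarAlgAut ℂ B (u χ) (T b) =
      T (Unitary.conjStarAlgAut ℂ B (u χ) b)) (g : G) :
    ψ.schur (ψ.X (fun χ => (u χ : B)) g) T = ψ.schur T (ψ.X (fun χ => (u χ : B)) g) := by
  simp only [X_eq, schur_smul_left, schur_smul_right, schur_sum_left, schur_sum_right]
  congr! 3 with χ
  ext x
  rw [schur_rankOne_left, ψ.schur_rankOne_right _ _ _ (map_star_unitary_mul huψ χ)]
  have h := congrArg (· * (u χ : B)) (hT χ (star (u χ : B) * x))
  simp only [Unitary.conjStarAlgAut_apply] at h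
  rwa [mul_assoc, Unitary.star_mul_self_of_mem (u χ).2, mul_one, ← mul_assoc (u χ : B),
    Unitary.mul_star_self_of_mem (u χ).2, one_mul] at h

-- Since ψ is tracial against u_χ, conjugation exchanges the terms of χ and χ⁻¹, and the
-- coefficients are conjugated accordingly.
omit [FiniteDimensional ℂ B] in
lemma starConj_X (g : G) :
    starConj (ψ.X (fun χ => (u χ : B)) g) = ψ.X (fun χ => (u χ : B)) g := by
  have h (χ : DualGroup G) (x : B) : star (ψ.rankOne (u χ : B) (u χ) (star x)) =
      ψ.rankOne (u χ⁻¹ : B) (u χ⁻¹) x := by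
    rw [← starConj_apply, ψ.starConj_rankOne (c := (u χ⁻¹ : B))]
    · rw [coe_unitary_inv]
    · intro y
      rw [← map_unitary_mul huψ, coe_unitary_inv, star_star]
  ext x
  rw [starConj_apply, X_eq]
  simp only [LinearMap.smul_apply, LinearMap.sum_apply, star_smul, star_sum, h, star_inv₀,
    star_natCast, star_star]
  congr 1
  refine Fintype.sum_equiv (Equiv.inv _) _ _ fun χ => ?_
  simp [DualGroup.star_coe]

end FaithfulFunctional

/-! ### The action of G against the Schur projections. -/

section Action

variable {B : Type u} [CStarAlgebra B] {ψ : FaithfulFunctional B}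
  {G : Type v} [CommGroup G] {α : G →* (B ≃⋆ₐ[ℂ] B)} {u : DualGroup G →* unitary B}

lemma action_mul_apply (g h : G) (b : B) : α (g * h) b = α g (α h b) := by
  rw [map_mul]; rfl

lemma action_one_apply (b : B) : α 1 b = b := by
  rw [map_one]; rfl

namespace IsEigenRepresentation

variable (hu : IsEigenRepresentation α u)
include hu

lemma action_star (g : G) (χ : DualGroup G) :
    α g (star (u χ : B)) = star (χ g : ℂ) • star (u χ : B) := by
  rw [map_star, hu, star_smul]

lemma action_conj (g : G) (χ : DualGroup G) (b : B) :
    α g (Unitary.conjStarAlgAut ℂ B (u χ) b) = Unitary.conjStarAlgAut ℂ B (u χ) (α g b) := by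
  have h : star (χ g : ℂ) * (χ g : ℂ) = 1 := by
    rw [DualGroup.star_coe', ← Circle.coe_mul, ← map_mul, inv_mul_cancel, map_one, Circle.coe_one]
  simp only [Unitary.conjStarAlgAut_apply, map_mul, hu g χ, hu.action_star, smul_mul_assoc,
    mul_smul_comm, smul_smul, h, one_smul]

variable [Fintype G]

/-- Applying α_h multiplies the χ term by χ(h), which amounts to translating the index.
`X_comp_action` gives the same index for α_h on the other side. -/
lemma action_comp_X (g h : G) :
    (α h).asLinearEquiv.toLinearMap ∘ₗ ψ.X (fun χ => (u χ : B)) g =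
      ψ.X (fun χ => (u χ : B)) (g * h⁻¹) := by
  ext x
  have h1 (χ : DualGroup G) : α h (ψ.rankOne (u χ : B) (u χ) x) =
      (χ h : ℂ) • ψ.rankOne (u χ : B) (u χ) x := by
    rw [ψ.rankOne_apply, map_smul, hu, smul_comm]
  change α h _ = _
  rw [ψ.X_eq, ψ.X_eq]
  simp only [LinearMap.smul_apply, LinearMap.sum_apply, map_smul, map_sum, h1, smul_smul,
    DualGroup.star_coe', mul_inv_rev, inv_inv, ← Circle.coe_mul, ← map_mul, mul_comm]

lemma X_comp_action (hψ : ∀ g b, ψ (α g b) = ψ b) (g h : G) :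
    ψ.X (fun χ => (u χ : B)) g ∘ₗ (α h).asLinearEquiv.toLinearMap =
      ψ.X (fun χ => (u χ : B)) (g * h⁻¹) := by
  ext x
  have h1 (χ : DualGroup G) : ψ.rankOne (u χ : B) (u χ) (α h x) =
      (χ h : ℂ) • ψ.rankOne (u χ : B) (u χ) x := by
    rw [ψ.rankOne_apply, ψ.rankOne_apply, ← hψ h⁻¹, map_mul, hu.action_star, ← action_mul_apply,
      inv_mul_cancel, action_one_apply, smul_mul_assoc, map_smul, smul_assoc,
      DualGroup.star_coe', inv_inv]
  change ψ.X _ g (α h x) = _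
  rw [ψ.X_eq, ψ.X_eq]
  simp only [LinearMap.smul_apply, LinearMap.sum_apply, h1, smul_smul,
    DualGroup.star_coe', mul_inv_rev, inv_inv, ← Circle.coe_mul, ← map_mul, mul_comm]

variable [FiniteDimensional ℂ B]

-- The χ term is u_χ α_h(u_χ* x), a multiple of α_h(x) by the conjugate of χ(h). So α_h lies in the
-- Schur block of X_{h⁻¹}.
open Classical in
lemma schur_X_action (g h : G) :
    ψ.schur (ψ.X (fun χ => (u χ : B)) g) (α h).asLinearEquiv.toLinearMap =
      if g * h = 1 then (α h).asLinearEquiv.toLinearMap else 0 := by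
  have h1 (χ : DualGroup G) : ψ.schur (star (χ g : ℂ) • ψ.rankOne (u χ : B) (u χ))
      (α h).asLinearEquiv.toLinearMap =
      (χ (g * h)⁻¹ : ℂ) • (α h).asLinearEquiv.toLinearMap := by
    ext x
    rw [ψ.schur_smul_left, LinearMap.smul_apply, ψ.schur_rankOne_left]
    change star (χ g : ℂ) • ((u χ : B) * α h (star (u χ : B) * x)) = (χ (g * h)⁻¹ : ℂ) • α h x
    rw [map_mul, hu.action_star, smul_mul_assoc, mul_smul_comm, smul_smul, ← mul_assoc,
      Unitary.mul_star_self_of_mem (u χ).2, one_mul, DualGroup.star_coe', DualGroup.star_coe',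
      mul_inv, map_mul, Circle.coe_mul]
  rw [ψ.X_eq, ψ.schur_smul_left, ψ.schur_sum_left]
  simp only [h1]
  rw [← Finset.sum_smul, DualGroup.sum_apply_dual]
  simp only [inv_eq_one]
  split_ifs
  · rw [smul_smul, inv_mul_cancel₀ (by simp), one_smul]
  · simp

variable (huψ : ∀ χ b, ψ (Unitary.conjStarAlgAut ℂ B (u χ) b) = ψ b)
  (hψ : ∀ g b, ψ (α g b) = ψ b)
include huψ hψ

open Classical in
lemma schur_action_action (hB : ψ.IsQuantumSet) (g h : G) :
    ψ.schur (α g).asLinearEquiv.toLinearMap (α h).asLinearEquiv.toLinearMap =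
      if g = h then (α g).asLinearEquiv.toLinearMap else 0 := by
  split_ifs with hgh
  · subst hgh
    have h1 := ψ.schur_comp_starAlgEquiv (α g) (hψ g) LinearMap.id LinearMap.id
    rw [ψ.schur_id_id_iff.1 hB, LinearMap.id_comp] at h1
    exact h1.symm
  · have h1 : ψ.schur (ψ.X (fun χ => (u χ : B)) g⁻¹) (α g).asLinearEquiv.toLinearMap =
        (α g).asLinearEquiv.toLinearMap := by
      rw [hu.schur_X_action, if_pos (inv_mul_cancel g)]
    -- Insert X_{g⁻¹} into the first factor and move it next to α_h, which it annihilates.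
    rw [← h1, ψ.schur_X_comm huψ (fun χ b => (hu.action_conj g χ b).symm), ψ.schur_assoc,
      hu.schur_X_action, if_neg (fun h => hgh (inv_mul_eq_one.1 h)), ψ.schur_zero_right]

end IsEigenRepresentation

end Action

/-! ### The orbit sum and the Schur embedding of End(B^α) into End(B). -/

section Expectation

variable {B : Type u} [CStarAlgebra B] [FiniteDimensional ℂ B]
  {G : Type v} [CommGroup G] [Fintype G] (α : G →* (B ≃⋆ₐ[ℂ] B))

/-- The sum over the orbit, as a map to the fixed point algebra. -/
def orbitSum : B →ₗ[ℂ] fixedPointAlgebra α where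
  toFun b := ⟨∑ g, α g b, fun h => by
    rw [map_sum]
    exact Fintype.sum_equiv (Equiv.mulLeft h) _ _ fun g => (action_mul_apply h g b).symm⟩
  map_add' a b := Subtype.ext <| by
    simp only [map_add, Finset.sum_add_distrib]; rfl
  map_smul' r a := Subtype.ext <| by
    simp only [map_smul, ← Finset.smul_sum]; rfl

/-- The inclusion of the fixed point algebra. -/
def fixedIncl : fixedPointAlgebra α →ₗ[ℂ] B := (fixedPointAlgebra α).subtype.toLinearMap

variable {α}

lemma coe_orbitSum (b : B) : (orbitSum α b : B) = ∑ g, α g b := rfl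

lemma orbitSum_coe (c : fixedPointAlgebra α) :
    orbitSum α c = (Fintype.card G : ℂ) • c := by
  apply Subtype.ext
  rw [coe_orbitSum, Finset.sum_congr rfl fun g _ => c.2 g, Finset.sum_const, Finset.card_univ,
    ← Nat.cast_smul_eq_nsmul ℂ]
  rfl

lemma orbitSum_coe_mul (c : fixedPointAlgebra α) (b : B) :
    orbitSum α (c * b) = c * orbitSum α b := by
  apply Subtype.ext
  change ∑ g, α g (c * b) = c * ∑ g, α g b
  rw [Finset.mul_sum]
  exact Finset.sum_congr rfl fun g _ => by rw [map_mul, c.2 g]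

variable {ψ : FaithfulFunctional B}

lemma restrictFixed_apply (c : fixedPointAlgebra α) :
    ψ.restrictFixed α c = (Fintype.card G : ℂ)⁻¹ * ψ (c : B) := rfl

lemma map_orbitSum (hψ : ∀ g b, ψ (α g b) = ψ b) (b : B) :
    ψ (orbitSum α b : B) = (Fintype.card G : ℂ) * ψ b := by
  rw [coe_orbitSum, map_sum, Finset.sum_congr rfl fun g _ => hψ g b]
  simp

lemma restrictFixed_orbitSum (hψ : ∀ g b, ψ (α g b) = ψ b) (b : B) :
    ψ.restrictFixed α (orbitSum α b) = ψ b := by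
  rw [restrictFixed_apply, map_orbitSum hψ, inv_mul_cancel_left₀ (by simp)]

/-- The extension of an operator on the fixed point algebra to an operator on the full algebra. -/
def extendFixed (α : G →* (B ≃⋆ₐ[ℂ] B)) :
    (fixedPointAlgebra α →ₗ[ℂ] fixedPointAlgebra α) →+ (B →ₗ[ℂ] B) :=
  AddMonoidHom.mk' (fun T => fixedIncl α ∘ₗ T ∘ₗ orbitSum α) fun S T => by
    rw [LinearMap.add_comp, LinearMap.comp_add]

lemma extendFixed_apply (T : fixedPointAlgebra α →ₗ[ℂ] fixedPointAlgebra α) (b : B) :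
    extendFixed α T b = T (orbitSum α b) := rfl

lemma extendFixed_injective : Function.Injective (extendFixed α) := by
  intro S T h
  ext c
  -- The orbit sum of c / n is c for fixed c.
  have h1 := LinearMap.congr_fun h ((Fintype.card G : ℂ)⁻¹ • (c : B))
  rw [extendFixed_apply, extendFixed_apply, map_smul, orbitSum_coe,
    inv_smul_smul₀ (by simp)] at h1
  exact h1

/-- The factor 1/n in the functional on B^α makes its composite with the orbit sum equal to ψ. Hence
|a⟩⟨b| on B^α extends to |a⟩⟨b| on B. -/
lemma extendFixed_schur (hψ : ∀ g b, ψ (α g b) = ψ b)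
    (S T : fixedPointAlgebra α →ₗ[ℂ] fixedPointAlgebra α) :
    extendFixed α ((ψ.restrictFixed α).schur S T) =
      ψ.schur (extendFixed α S) (extendFixed α T) := by
  have h (a b : fixedPointAlgebra α) :
      extendFixed α ((ψ.restrictFixed α).rankOne a b) = ψ.rankOne (a : B) b := by
    ext x
    rw [extendFixed_apply, FaithfulFunctional.rankOne_apply, FaithfulFunctional.rankOne_apply,
      ← orbitSum_coe_mul, restrictFixed_orbitSum hψ]
    rfl
  refine (ψ.restrictFixed α).map_schur_of_rankOne ψ _ (fun a b c d => ?_) S T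
  simp only [h, ψ.schur_rankOne]
  rfl

lemma extendFixed_id :
    extendFixed α LinearMap.id = ∑ g, (α g).asLinearEquiv.toLinearMap := by
  ext b
  rw [LinearMap.sum_apply]
  rfl

end Expectation

/-! ### The adjoint of the expectation on a crossed product. -/

namespace CrossedProduct

variable {K : Type v} [Group K] [Fintype K] {C : Type u} [CStarAlgebra C] [FiniteDimensional ℂ C]
  {β : K →* (C ≃⋆ₐ[ℂ] C)}

lemma functional_apply (ψ : FaithfulFunctional C) (f : CrossedProduct β) :
    functional β ψ f = (Fintype.card K : ℂ) * ψ (coeff 1 f) := rfl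

omit [FiniteDimensional ℂ C] in
lemma E_apply (f : CrossedProduct β) : E β f = (Fintype.card K : ℂ) • coeff 1 f := rfl

lemma adjoint_E (ψ : FaithfulFunctional C) (c : C) :
    (functional β ψ).adjoint ψ (E β) c = single 1 c := by
  classical
  set y := (functional β ψ).adjoint ψ (E β) c
  have h1 (f : CrossedProduct β) : functional β ψ (star f * y) =
      functional β ψ (star f * single 1 c) := by
    rw [← (functional β ψ).adjoint_spec ψ (E β) f c, functional_apply, coeff_mul,
      Finset.sum_eq_single 1]
    · rw [coeff_star, coeff_single, E_apply]
      simp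
    · intro k _ hk
      rw [coeff_single, if_neg (by simpa using hk)]
      simp
    · simp
  -- Both candidates have the same inner product with every f; take f to be their difference and use
  -- faithfulness.
  rw [← sub_eq_zero]
  apply (functional β ψ).faithful
  rw [mul_sub, map_sub, h1, sub_self]

end CrossedProduct

/-! ### Identification of B with the crossed product of B^α. -/

namespace IsEigenRepresentation

open CrossedProduct

variable {B : Type u} [CStarAlgebra B] [FiniteDimensional ℂ B]
  {G : Type v} [CommGroup G] [Fintype G]
  {α : G →* (B ≃⋆ₐ[ℂ] B)} {u : DualGroup G →* unitary B} (hu : IsEigenRepresentation α u)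

omit [FiniteDimensional ℂ B] [Fintype G] in
include hu in
lemma action_coe_mul (g : G) (c : fixedPointAlgebra α) (χ : DualGroup G) :
    α g (c * (u χ : B)) = (χ g : ℂ) • (c * (u χ : B)) := by
  rw [map_mul, c.2 g, hu, mul_smul_comm]

include hu in
open Classical in
lemma orbitSum_coe_mul (c : fixedPointAlgebra α) (χ : DualGroup G) :
    orbitSum α (c * (u χ : B)) = if χ = 1 then (Fintype.card G : ℂ) • c else 0 := by
  apply Subtype.ext
  rw [coe_orbitSum]
  simp only [hu.action_coe_mul]
  rw [← Finset.sum_smul, DualGroup.sum_apply_group]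
  split_ifs with h
  · rw [h, map_one]
    change _ • ((c : B) * 1) = _
    rw [mul_one]
    rfl
  · rw [zero_smul]
    rfl

-- Fourier inversion: the left side is the double sum of conj χ(g) α_g(b), and summing over χ leaves
-- only g = 1.
include hu in
lemma sum_orbitSum_mul (b : B) :
    ∑ χ : DualGroup G, (orbitSum α (b * star (u χ : B)) : B) * u χ =
      (Fintype.card G : ℂ) • b := by
  classical
  simp only [coe_orbitSum, map_mul, hu.action_star, mul_smul_comm, Finset.sum_mul,
    smul_mul_assoc, mul_assoc, Unitary.star_mul_self_of_mem (u _).2, mul_one]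
  rw [Finset.sum_comm]
  simp only [← Finset.sum_smul, DualGroup.star_coe', DualGroup.sum_apply_dual, inv_eq_one]
  simp

/-- The map `∑ χ, c_χ u_χ ↦ ∑ χ, c_χ u_χ` from the crossed product to the algebra. -/
def integratedForm : CrossedProduct hu.dualAction →ₗ[ℂ] B :=
  ∑ χ : DualGroup G, LinearMap.mulRight ℂ (u χ : B) ∘ₗ fixedIncl α ∘ₗ coeff χ

lemma integratedForm_apply (f : CrossedProduct hu.dualAction) :
    hu.integratedForm f = ∑ χ : DualGroup G, ((coeff χ f : fixedPointAlgebra α) : B) * u χ :=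
  LinearMap.sum_apply _ _ _

/-- The map sending `b` to the family of its Fourier coefficients. -/
def fourierCoeff (b : B) : CrossedProduct hu.dualAction :=
  fun χ => (Fintype.card G : ℂ)⁻¹ • orbitSum α (b * star (u χ : B))

lemma coeff_fourierCoeff (b : B) (χ : DualGroup G) :
    coeff χ (hu.fourierCoeff b) = (Fintype.card G : ℂ)⁻¹ • orbitSum α (b * star (u χ : B)) := rfl

lemma fourierCoeff_integratedForm (f : CrossedProduct hu.dualAction) :
    hu.fourierCoeff (hu.integratedForm f) = f := by
  classical
  refine CrossedProduct.ext fun ξ => ?_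
  have h (χ : DualGroup G) : orbitSum α (((coeff χ f : fixedPointAlgebra α) : B) * u χ * star (u ξ : B)) =
      if χ = ξ then (Fintype.card G : ℂ) • coeff χ f else 0 := by
    have h1 : ((coeff χ f : fixedPointAlgebra α) : B) * u χ * star (u ξ : B) = coeff χ f * u (χ * ξ⁻¹) := by
      rw [← FaithfulFunctional.coe_unitary_inv, map_mul, mul_assoc]; rfl
    rw [h1, hu.orbitSum_coe_mul]
    simp only [mul_inv_eq_one]
  rw [coeff_fourierCoeff, integratedForm_apply, Finset.sum_mul, map_sum]
  simp only [h]
  rw [Finset.sum_ite_eq' Finset.univ ξ, if_pos (Finset.mem_univ _), inv_smul_smul₀ (by simp)]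

lemma integratedForm_fourierCoeff (b : B) : hu.integratedForm (hu.fourierCoeff b) = b := by
  rw [integratedForm_apply]
  have h (χ : DualGroup G) : ((coeff χ (hu.fourierCoeff b) : fixedPointAlgebra α) : B) * u χ =
      (Fintype.card G : ℂ)⁻¹ • ((orbitSum α (b * star (u χ : B)) : B) * u χ) :=
    smul_mul_assoc _ _ _
  rw [Finset.sum_congr rfl fun χ _ => h χ, ← Finset.smul_sum, hu.sum_orbitSum_mul,
    inv_smul_smul₀ (by simp)]

lemma integratedForm_mul (f g : CrossedProduct hu.dualAction) :
    hu.integratedForm (f * g) = hu.integratedForm f * hu.integratedForm g := by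
  have h (χ : DualGroup G) : ((coeff χ (f * g) : fixedPointAlgebra α) : B) =
      ∑ ξ, ((coeff ξ f : fixedPointAlgebra α) : B) * (u ξ * (coeff (ξ⁻¹ * χ) g : fixedPointAlgebra α) * star (u ξ : B)) := by
    rw [coeff_mul]
    exact map_sum (fixedIncl α) _ _
  simp only [integratedForm_apply, h, Finset.sum_mul]
  rw [Finset.sum_comm]
  refine Finset.sum_congr rfl fun ξ _ => ?_
  rw [Finset.mul_sum]
  refine Fintype.sum_equiv (Equiv.mulLeft ξ⁻¹) _ _ fun χ => ?_
  have h1 : star (u ξ : B) * u χ = u (ξ⁻¹ * χ) := by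
    rw [← FaithfulFunctional.coe_unitary_inv, map_mul]; rfl
  simp only [Equiv.coe_mulLeft, ← h1, mul_assoc]

lemma integratedForm_star (f : CrossedProduct hu.dualAction) :
    hu.integratedForm (star f) = star (hu.integratedForm f) := by
  rw [integratedForm_apply, integratedForm_apply, star_sum]
  refine Fintype.sum_equiv (Equiv.inv _) _ _ fun χ => ?_
  have h : ((coeff χ (star f) : fixedPointAlgebra α) : B) = u χ * star ((coeff χ⁻¹ f : fixedPointAlgebra α) : B) * star (u χ : B) := rfl
  rw [h, mul_assoc, Unitary.star_mul_self_of_mem (u χ).2, mul_one, star_mul, Equiv.inv_apply,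
    FaithfulFunctional.coe_unitary_inv, star_star]

/-- The algebra is the crossed product of the fixed point algebra by the dual action. -/
def crossedProductEquiv : CrossedProduct hu.dualAction ≃⋆ₐ[ℂ] B where
  toFun := hu.integratedForm
  invFun := hu.fourierCoeff
  left_inv := hu.fourierCoeff_integratedForm
  right_inv := hu.integratedForm_fourierCoeff
  map_mul' := hu.integratedForm_mul
  map_add' := map_add hu.integratedForm
  map_star' := hu.integratedForm_star
  map_smul' := map_smul hu.integratedForm

lemma crossedProductEquiv_apply (f : CrossedProduct hu.dualAction) :
    hu.crossedProductEquiv f = ∑ χ : DualGroup G, ((coeff χ f : fixedPointAlgebra α) : B) * u χ :=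
  hu.integratedForm_apply f

lemma crossedProductEquiv_single (χ : DualGroup G) (c : fixedPointAlgebra α) :
    hu.crossedProductEquiv (single χ c) = c * u χ := by
  classical
  rw [crossedProductEquiv_apply, Finset.sum_eq_single χ]
  · rw [coeff_single, if_pos rfl]
  · intro ξ _ h
    rw [coeff_single, if_neg h]
    exact zero_mul _
  · simp

lemma orbitSum_crossedProductEquiv (f : CrossedProduct hu.dualAction) :
    orbitSum α (hu.crossedProductEquiv f) = E hu.dualAction f := by
  classical
  -- E is normalized by the order of the dual group, the orbit sum by the order of G; the two orders
  -- agree.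
  rw [crossedProductEquiv_apply, map_sum, E_apply, DualGroup.card_eq]
  simp only [hu.orbitSum_coe_mul]
  rw [Finset.sum_ite_eq' Finset.univ, if_pos (Finset.mem_univ _)]

variable {ψ : FaithfulFunctional B} (hψ : ∀ g b, ψ (α g b) = ψ b)

include hψ in
lemma functional_crossedProductEquiv (f : CrossedProduct hu.dualAction) :
    ψ (hu.crossedProductEquiv f) =
      functional hu.dualAction (ψ.restrictFixed α) f := by
  rw [← restrictFixed_orbitSum hψ, orbitSum_crossedProductEquiv, E_apply, map_smul]
  rfl

include hψ in
lemma functional_crossedProductEquiv_symm (b : B) :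
    functional hu.dualAction (ψ.restrictFixed α) (hu.crossedProductEquiv.symm b) = ψ b := by
  rw [← hu.functional_crossedProductEquiv hψ, StarAlgEquiv.apply_symm_apply]

include hψ in
lemma conj_X (g : G) :
    hu.crossedProductEquiv.symm.asLinearEquiv.conj (ψ.X (fun χ => (u χ : B)) g) =
      (functional hu.dualAction (ψ.restrictFixed α)).X
        (fun χ : DualGroup G => single χ 1) g := by
  have h (χ : DualGroup G) :
      hu.crossedProductEquiv.symm (u χ : B) = (single χ 1 : CrossedProduct hu.dualAction) := by
    rw [← hu.crossedProductEquiv.symm_apply_apply (single χ 1), crossedProductEquiv_single]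
    exact congrArg _ (one_mul _).symm
  ext1 f
  change hu.crossedProductEquiv.symm (ψ.X (fun χ => (u χ : B)) g (hu.crossedProductEquiv f)) = _
  rw [ψ.X_eq, FaithfulFunctional.X_eq]
  simp only [LinearMap.smul_apply, LinearMap.sum_apply, map_smul, map_sum,
    FaithfulFunctional.rankOne_apply, h]
  congr! 5 with χ
  rw [← hu.functional_crossedProductEquiv_symm hψ, map_mul, map_star, h,
    StarAlgEquiv.symm_apply_apply]

/-- Under the identification the orbit sum is E, and the inclusion c ↦ c u_1 is its adjoint. -/
lemma conj_extendFixed (T : fixedPointAlgebra α →ₗ[ℂ] fixedPointAlgebra α) :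
    hu.crossedProductEquiv.symm.asLinearEquiv.conj (extendFixed α T) =
      (functional hu.dualAction (ψ.restrictFixed α)).adjoint (ψ.restrictFixed α)
        (E hu.dualAction) ∘ₗ T ∘ₗ E hu.dualAction := by
  ext1 f
  change hu.crossedProductEquiv.symm (T (orbitSum α (hu.crossedProductEquiv f)) : B) =
    (functional hu.dualAction (ψ.restrictFixed α)).adjoint (ψ.restrictFixed α)
        (E hu.dualAction) (T (E hu.dualAction f))
  rw [adjoint_E, orbitSum_crossedProductEquiv,
    ← hu.crossedProductEquiv.symm_apply_apply (single 1 _), crossedProductEquiv_single, map_one]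
  exact congrArg _ (mul_one _).symm

include hψ in
lemma derivedQuantumGraph_eq_conj (At : G → fixedPointAlgebra α →ₗ[ℂ] fixedPointAlgebra α) :
    derivedQuantumGraph (ψ.restrictFixed α) hu.dualAction At =
      hu.crossedProductEquiv.symm.asLinearEquiv.conj
        (∑ g, ψ.schur (ψ.X (fun χ => (u χ : B)) g) (extendFixed α (At g))) := by
  rw [map_sum]
  refine Finset.sum_congr rfl fun g _ => ?_
  rw [ψ.schur_conj (functional hu.dualAction (ψ.restrictFixed α)) _
    (hu.functional_crossedProductEquiv_symm hψ), hu.conj_X hψ, hu.conj_extendFixed]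

end IsEigenRepresentation

/-! ### The voltage graph and the recovery of A from it. -/

section Voltage

variable {B : Type u} [CStarAlgebra B] [FiniteDimensional ℂ B]
  {G : Type v} [CommGroup G] [Fintype G] {ψ : FaithfulFunctional B} {A : B →ₗ[ℂ] B}
  {α : G →* (B ≃⋆ₐ[ℂ] B)} {u : DualGroup G →* unitary B}

/-- An invariant operator restricts to the fixed point algebra. -/
def restrictOperator (T : B →ₗ[ℂ] B)
    (hT : ∀ g b, α g (T b) = T (α g b)) : fixedPointAlgebra α →ₗ[ℂ] fixedPointAlgebra α where
  toFun c := ⟨T c, fun g => by rw [hT, c.2 g]⟩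
  map_add' a b := Subtype.ext (map_add T (a : B) b)
  map_smul' r a := Subtype.ext (map_smul T r (a : B))

lemma extendFixed_restrictOperator (T : B →ₗ[ℂ] B) (hT : ∀ g b, α g (T b) = T (α g b)) :
    extendFixed α (restrictOperator T hT) =
      ∑ g, T ∘ₗ (α g).asLinearEquiv.toLinearMap := by
  ext b
  rw [LinearMap.sum_apply]
  exact map_sum T _ _

namespace IsEigenRepresentation

variable (hu : IsEigenRepresentation α u)
  (hψ : ∀ g b, ψ (α g b) = ψ b) (hA : ∀ g b, α g (A b) = A (α g b))
include hu hψ hA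

/-- Composing with α_h on either side turns X_g into X_{gh⁻¹} and A into A α_h. This invariance is
what lets X_g • A restrict to B^α. -/
lemma action_schur_X (g h : G) (b : B) :
    α h (ψ.schur (ψ.X (fun χ => (u χ : B)) g) A b) =
      ψ.schur (ψ.X (fun χ => (u χ : B)) g) A (α h b) := by
  have hc : (α h).asLinearEquiv.toLinearMap ∘ₗ A = A ∘ₗ (α h).asLinearEquiv.toLinearMap :=
    LinearMap.ext (hA h)
  change ((α h).asLinearEquiv.toLinearMap ∘ₗ ψ.schur _ A) b =
    (ψ.schur _ A ∘ₗ (α h).asLinearEquiv.toLinearMap) b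
  rw [ψ.starAlgEquiv_comp_schur, ψ.schur_comp_starAlgEquiv _ (hψ h), hu.action_comp_X,
    hu.X_comp_action hψ, hc]

lemma extendFixed_schur_X (g : G) :
    extendFixed α (restrictOperator (ψ.schur (ψ.X (fun χ => (u χ : B)) g) A)
      (hu.action_schur_X hψ hA g)) =
      ∑ h, ψ.schur (ψ.X (fun χ => (u χ : B)) (g * h⁻¹))
        (A ∘ₗ (α h).asLinearEquiv.toLinearMap) := by
  rw [extendFixed_restrictOperator]
  refine Finset.sum_congr rfl fun h _ => ?_
  rw [ψ.schur_comp_starAlgEquiv _ (hψ h), hu.X_comp_action hψ]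

lemma sum_schur_X_extendFixed :
    ∑ g, ψ.schur (ψ.X (fun χ => (u χ : B)) g)
      (extendFixed α (restrictOperator (ψ.schur (ψ.X (fun χ => (u χ : B)) g) A)
        (hu.action_schur_X hψ hA g))) = A := by
  classical
  have h (g : G) : ψ.schur (ψ.X (fun χ => (u χ : B)) g)
      (extendFixed α (restrictOperator (ψ.schur (ψ.X (fun χ => (u χ : B)) g) A)
        (hu.action_schur_X hψ hA g))) = ψ.schur (ψ.X (fun χ => (u χ : B)) g) A := by
    have h1 : A ∘ₗ (α 1).asLinearEquiv.toLinearMap = A := by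
      ext b
      exact congrArg A (action_one_apply b)
    -- Orthogonality of X_g and X_{gh⁻¹} for h ≠ 1 leaves a single term.
    rw [hu.extendFixed_schur_X hψ hA, ψ.schur_sum_right, Finset.sum_eq_single 1]
    · rw [← ψ.schur_assoc, inv_one, mul_one, ψ.schur_X_X, if_pos rfl, h1]
    · intro h _ hh
      rw [← ψ.schur_assoc, ψ.schur_X_X, if_neg (by simpa using hh), ψ.schur_zero_left]
    · simp
  rw [Finset.sum_congr rfl fun g _ => h g, ← ψ.schur_sum_left, ψ.sum_X,
    ψ.schur_rankOne_one_left]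

omit hA in
lemma isQuantumSet_restrictFixed (hB : ψ.IsQuantumSet)
    (huψ : ∀ χ b, ψ (Unitary.conjStarAlgAut ℂ B (u χ) b) = ψ b) :
    (ψ.restrictFixed α).IsQuantumSet := by
  classical
  rw [FaithfulFunctional.schur_id_id_iff]
  apply extendFixed_injective
  rw [extendFixed_schur hψ, extendFixed_id, ψ.schur_sum_left]
  refine Finset.sum_congr rfl fun g _ => ?_
  rw [ψ.schur_sum_right]
  simp only [hu.schur_action_action huψ hψ hB]
  rw [Finset.sum_ite_eq Finset.univ, if_pos (Finset.mem_univ _)]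

variable (huψ : ∀ χ b, ψ (Unitary.conjStarAlgAut ℂ B (u χ) b) = ψ b)
  (huA : ∀ χ b, Unitary.conjStarAlgAut ℂ B (u χ) (A b) =
    A (Unitary.conjStarAlgAut ℂ B (u χ) b))
include huψ huA

lemma isQuantumAdjacency_schur_X (hadj : ψ.IsQuantumAdjacency A) (g : G) :
    (ψ.restrictFixed α).IsQuantumAdjacency
      (restrictOperator (ψ.schur (ψ.X (fun χ => (u χ : B)) g) A)
        (hu.action_schur_X hψ hA g)) := by
  classical
  refine ⟨?_, fun c => Subtype.ext ?_⟩
  · apply extendFixed_injective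
    rw [extendFixed_schur hψ, hu.extendFixed_schur_X hψ hA, ψ.schur_sum_left]
    refine Finset.sum_congr rfl fun h _ => ?_
    have hcomm : ψ.schur (A ∘ₗ (α h).asLinearEquiv.toLinearMap)
        (ψ.X (fun χ => (u χ : B)) (g * h⁻¹)) =
        ψ.schur (ψ.X (fun χ => (u χ : B)) (g * h⁻¹))
          (A ∘ₗ (α h).asLinearEquiv.toLinearMap) := by
      refine (ψ.schur_X_comm huψ (fun χ b => ?_) _).symm
      exact (huA χ (α h b)).trans (congrArg A (hu.action_conj h χ b).symm)
    have hXX (k : G) : ψ.schur (ψ.schur (ψ.X (fun χ => (u χ : B)) (g * h⁻¹))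
          (A ∘ₗ (α h).asLinearEquiv.toLinearMap))
        (ψ.schur (ψ.X (fun χ => (u χ : B)) (g * k⁻¹))
          (A ∘ₗ (α k).asLinearEquiv.toLinearMap)) =
        if h = k then ψ.schur (ψ.X (fun χ => (u χ : B)) (g * h⁻¹))
          (A ∘ₗ (α h).asLinearEquiv.toLinearMap) else 0 := by
      -- Commuting the first pair brings X_{gh⁻¹} and X_{gk⁻¹} together in the middle, where they
      -- are orthogonal unless h = k.
      rw [← hcomm, ψ.schur_assoc, ← ψ.schur_assoc (ψ.X _ _), ψ.schur_X_X]
      by_cases hk : h = k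
      · subst hk
        rw [if_pos rfl, if_pos rfl, ← ψ.schur_assoc, hcomm, ψ.schur_assoc,
          ← ψ.schur_comp_starAlgEquiv _ (hψ h), hadj.schur_self]
      · rw [if_neg (by simpa using hk), if_neg hk, ψ.schur_zero_left, ψ.schur_zero_right]
    rw [ψ.schur_sum_right]
    simp only [hXX]
    rw [Finset.sum_ite_eq Finset.univ, if_pos (Finset.mem_univ _)]
  · have hstar : FaithfulFunctional.starConj A = A := by
      ext b
      rw [FaithfulFunctional.starConj_apply, hadj.star_map, star_star]
    -- `starConj` fixes X_g and A but reverses their Schur product; commutation restores the order.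
    have h := ψ.starConj_schur (ψ.X (fun χ => (u χ : B)) g) A
    rw [FaithfulFunctional.starConj_X huψ, hstar, ← ψ.schur_X_comm huψ huA] at h
    have h1 := LinearMap.congr_fun h (star (c : B))
    rw [FaithfulFunctional.starConj_apply, star_star] at h1
    exact h1.symm

omit hu hψ hA in
lemma conj_schur_X (g : G) (χ : DualGroup G) (b : B) :
    Unitary.conjStarAlgAut ℂ B (u χ) (ψ.schur (ψ.X (fun χ => (u χ : B)) g) A b) =
      ψ.schur (ψ.X (fun χ => (u χ : B)) g) A (Unitary.conjStarAlgAut ℂ B (u χ) b) := by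
  -- The dual group is abelian, so the u_ξ commute with each other and Ad(u_χ) commutes with X_g.
  have hfix (ξ : DualGroup G) : Unitary.conjStarAlgAut ℂ B (u χ) (u ξ : B) = u ξ := by
    have h : (u χ : B) * u ξ = u ξ * u χ :=
      congrArg Subtype.val (((map_mul u χ ξ).symm.trans (congrArg u (mul_comm χ ξ))).trans
        (map_mul u ξ χ))
    rw [Unitary.conjStarAlgAut_apply, h, mul_assoc, Unitary.mul_star_self_of_mem (u χ).2, mul_one]
  have hX (b : B) : Unitary.conjStarAlgAut ℂ B (u χ) (ψ.X (fun χ => (u χ : B)) g b) =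
      ψ.X (fun χ => (u χ : B)) g (Unitary.conjStarAlgAut ℂ B (u χ) b) := by
    have hr (ξ : DualGroup G) : ψ (star (u ξ : B) * Unitary.conjStarAlgAut ℂ B (u χ) b) =
        ψ (star (u ξ : B) * b) := by
      rw [← huψ χ (star (u ξ : B) * b), map_mul (Unitary.conjStarAlgAut ℂ B (u χ)),
        map_star (Unitary.conjStarAlgAut ℂ B (u χ)), hfix]
    rw [ψ.X_eq]
    simp only [LinearMap.smul_apply, LinearMap.sum_apply, map_smul, map_sum,
      FaithfulFunctional.rankOne_apply, hfix, hr]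
  let γ : B ≃⋆ₐ[ℂ] B := Unitary.conjStarAlgAut ℂ B (u χ)
  have h1 : γ.asLinearEquiv.toLinearMap ∘ₗ A = A ∘ₗ γ.asLinearEquiv.toLinearMap :=
    LinearMap.ext (huA χ)
  have h2 : γ.asLinearEquiv.toLinearMap ∘ₗ ψ.X (fun χ => (u χ : B)) g =
      ψ.X (fun χ => (u χ : B)) g ∘ₗ γ.asLinearEquiv.toLinearMap := LinearMap.ext hX
  change (γ.asLinearEquiv.toLinearMap ∘ₗ ψ.schur _ A) b =
    (ψ.schur _ A ∘ₗ γ.asLinearEquiv.toLinearMap) b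
  rw [ψ.starAlgEquiv_comp_schur, ψ.schur_comp_starAlgEquiv γ (huψ χ), h1, h2]

end IsEigenRepresentation

end Voltage
end

theorem mainTheorem1 {B : Type*} [CStarAlgebra B] [FiniteDimensional ℂ B]
    {G : Type*} [CommGroup G] [Fintype G]
    (ψ : FaithfulFunctional B) (A : B →ₗ[ℂ] B) (hA : ψ.IsQuantumGraph A)
    (α : G →* (B ≃⋆ₐ[ℂ] B)) (hα : ∀ g, IsQuantumGraphIso ψ A ψ A (α g))
    (u : DualGroup G →* unitary B) (hu : IsEigenRepresentation α u)
    (huψ : ∀ χ b, ψ (Unitary.conjStarAlgAut ℂ B (u χ) b) = ψ b)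
    (huA : ∀ χ b, Unitary.conjStarAlgAut ℂ B (u χ) (A b) =
      A (Unitary.conjStarAlgAut ℂ B (u χ) b)) :
    ∃ At : G → fixedPointAlgebra α →ₗ[ℂ] fixedPointAlgebra α,
      (∀ g b, (At g b : B) = ψ.schur (ψ.X (fun χ => (u χ : B)) g) A b) ∧
      IsVoltageQuantumGraph (ψ.restrictFixed α) hu.dualAction At ∧
      (CrossedProduct.functional hu.dualAction (ψ.restrictFixed α)).IsQuantumGraph
        (derivedQuantumGraph (ψ.restrictFixed α) hu.dualAction At) ∧
      ∃ φ : B ≃⋆ₐ[ℂ] CrossedProduct hu.dualAction,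
        IsQuantumGraphIso ψ A
          (CrossedProduct.functional hu.dualAction (ψ.restrictFixed α))
          (derivedQuantumGraph (ψ.restrictFixed α) hu.dualAction At) φ := by
  have hψ : ∀ g b, ψ (α g b) = ψ b := fun g => (hα g).functional
  have hαA : ∀ g b, α g (A b) = A (α g b) := fun g => (hα g).adjacency
  have hiso : IsQuantumGraphIso ψ A
      (CrossedProduct.functional hu.dualAction (ψ.restrictFixed α))
      (derivedQuantumGraph (ψ.restrictFixed α) hu.dualAction fun g =>
        restrictOperator (ψ.schur (ψ.X (fun χ => (u χ : B)) g) A) (hu.action_schur_X hψ hαA g))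
      hu.crossedProductEquiv.symm := by
    refine ⟨hu.functional_crossedProductEquiv_symm hψ, fun b => ?_⟩
    rw [hu.derivedQuantumGraph_eq_conj hψ, hu.sum_schur_X_extendFixed hψ hαA]
    exact congrArg (fun x => hu.crossedProductEquiv.symm (A x))
      (hu.crossedProductEquiv.apply_symm_apply b).symm
  -- That the derived map is a quantum graph is transported from A along the isomorphism.
  refine ⟨_, fun g b => rfl, ⟨?_, fun χ c => ?_, ?_, fun g χ c => ?_⟩, hiso.isQuantumGraph hA,
    _, hiso⟩
  · exact hu.isQuantumSet_restrictFixed hψ hA.isQuantumSet huψ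
  · exact congrArg ((Fintype.card G : ℂ)⁻¹ * ·) (huψ χ c)
  · exact hu.isQuantumAdjacency_schur_X hψ hαA huψ huA hA.isQuantumAdjacency
  · exact Subtype.ext (IsEigenRepresentation.conj_schur_X huψ huA g χ c).symm
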